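/- A directed graph of groups $\mathcal G_+=(\Gamma_+,G)$ consists of a directed graph $\Gamma_+=(\Gamma^0,\Gamma^1_+,r,s)$, a group $G_v$ for each vertex $v$, a group $G_e$ for each edge $e\in\Gamma^1_+$, and injective homomorphisms $\alpha_e\colon G_e\to G_{r(e)}$ and $\alpha_{\overline e}\colon G_e\to G_{s(e)}$, where $\overline e$ is the formal reversal of $e$. Assume that $\mathcal G_+$ is countable ($\Gamma^0$, $\Gamma^1_+$ and all the groups are countable), row-finite (for each $v$ there are finitely many $e\in\Gamma^1_+$ with $r(e)=v$, and each $\alpha_e(G_e)$, $e\in\Gamma_+^1$, has finite index in $G_{r(e)}$) and has no sources (each $v$ is $r(e)$ for some $e\in\Gamma^1_+$). A set of transversals $\Sigma=\{\Sigma_e:e\in\Gamma^1_+\}$ consists of sets $\Sigma_e\subseteq G_{r(e)}$ of representatives of $G_{r(e)}/\alpha_e(G_e)$ with $1\in\Sigma_e$. A $(\mathcal G_+,\Sigma)$-family consists of partial isometries $S_e$ ($e\in\Gamma^1_+$) and of representations $g\mapsto U_{v,g}$ of $G_v$ by partial unitaries ($v\in\Gamma^0$), that is, $U_{v,gh}=U_{v,g}U_{v,h}$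 and each $U_{v,g}$ is a partial isometry with $U_{v,g}^*U_{v,g}=U_{v,g}U_{v,g}^*$, such that (1) $U_{v,1}U_{w,1}=0$ for $v\ne w$; (2) $U_{r(e),\alpha_e(g)}S_e=S_eU_{s(e),\alpha_{\overline e}(g)}$ for $g\in G_e$; (3) $U_{s(e),1}=S_e^*S_e$; (4) $U_{v,1}=\sum_{e\in\Gamma_+^1,\,r(e)=v}\sum_{h\in\Sigma_e}U_{v,h}S_eS_e^*U_{v,h}^*$. Let $C^*(\mathcal G_+)$ be the universal C*-algebra generated by a $(\mathcal G_+,\Sigma)$-family $\{s_e\}\cup\{u_{v,g}\}$. Let $F(\mathcal G)$ be the groupoid with object set $\Gamma^0$ generated by the edges $e,\overline e$ ($e\in\Gamma^1_+$), where $r(\overline e)=s(e)$ and $s(\overline e)=r(e)$, and by the elements of the groups $G_v$ (with range and source $v$), subject to the relations of the groups $G_v$, $\overline e=e^{-1}$, $\alpha_e(g)e=e\alpha_{\overline e}(g)$ and $\alpha_{\overline e}(g)\overline e=\overline e\alpha_e(g)$ for $e\in\Gamma^1_+$ and $g\in G_e$. The word category $\Lambda=\Lambda_{\mathcal G_+}$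 is the subcategory of the elements $g_1e_1g_2e_2\cdots g_ne_ng_{n+1}$ with $n\ge 0$, $e_i\in\Gamma^1_+$, $s(e_i)=r(e_{i+1})$, $g_i\in G_{r(e_i)}$ for $i\le n$ and $g_{n+1}\in G_{s(e_n)}$ (for $n=0$: $g_1\in G_v$ for some $v$). For a left cancellative small category $\Lambda$ which is finitely aligned (each $\lambda\Lambda\cap\mu\Lambda$ is a finite union of sets $\gamma\Lambda$), a Cuntz--Krieger $\Lambda$-family is a collection $\{S_\lambda:\lambda\in\Lambda\}$ such that (S1) $S_\lambda^*S_\lambda=S_{s(\lambda)}$; (S2) $S_\lambda S_\mu=S_{\lambda\mu}$ if $s(\lambda)=r(\mu)$; (S3) $S_\lambda S_\lambda^*S_\mu S_\mu^*=\bigvee_{\nu\in\lambda\vee\mu}S_\nu S_\nu^*$; (S4) $S_v=\bigvee_{\lambda\in F}S_\lambda S_\lambda^*$ for every object $v$ and every finite exhaustive $F\subseteq v\Lambda$. Here $\bigvee$ is the least upper bound among projections; objects are identified with their identity morphisms; $v\Lambda$ is the set of morphisms with range $v$; $\lambda\vee\mu$ is the set of those $\nu\in\lambda\Lambda\cap\mu\Lambda$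 such that $\nu\in\delta\Lambda$ with $\delta\in\lambda\Lambda\cap\mu\Lambda$ implies $\delta\in\nu\Lambda$; and $F$ is exhaustive if for each $\alpha\in v\Lambda$ there is $\beta\in F$ with $\alpha\Lambda\cap\beta\Lambda\ne\emptyset$. Spielberg's Cuntz--Krieger algebra $\mathcal O(\Lambda)$ is the universal C*-algebra generated by a Cuntz--Krieger $\Lambda$-family $\{t_\lambda\}$. Theorem. Let $\mathcal G_+$ be a countable, row-finite directed graph of groups with no sources, and let $\Sigma$ be a set of transversals for $\mathcal G_+$. Then $\Lambda_{\mathcal G_+}$ is left cancellative and finitely aligned, and there is a unique isomorphism of C*-algebras $$\Phi\colon C^*(\mathcal G_+)\to\mathcal O(\Lambda_{\mathcal G_+}),\qquad \Phi(s_e)=t_{1_{r(e)}\,e\,1_{s(e)}},\qquad \Phi(u_{v,g})=t_g$$ for all $e\in\Gamma^1_+$, $v\in\Gamma^0$ and $g\in G_v$. In particular $C^*(\mathcal G_+)$ does not depend on $\Sigma$: if $\Sigma'$ is another set of transversals, there is a unique isomorphism from the algebra formed with $\Sigma$ onto the algebra formed with $\Sigma'$ which sends $s_e\mapsto s_e$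 and $u_{v,g}\mapsto u_{v,g}$ for all $e$, $v$ and $g$. -/

import Mathlib

open scoped ENNReal
open CategoryTheory

universe u w

/-! ### Universal C*-algebras of generators and relations -/

/-- Relations on a set `X` of generators: a class of maps from `X` to C*-algebras (the families
satisfying the relations), all of whose members consist of contractions. -/
structure CStarRelations (X : Type u) where
  holds : ∀ (A : Type u) [NonUnitalCStarAlgebra A], (X → A) → Prop
  norm_le_one : ∀ (A : Type u) [NonUnitalCStarAlgebra A] (f : X → A),
    holds A f → ∀ x, ‖f x‖ ≤ 1

namespace CStarRelations

variable {X : Type u} (R : CStarRelations X)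

/-- A family satisfying the relations, in some C*-algebra. -/
structure Rep where
  alg : Type u
  [inst : NonUnitalCStarAlgebra alg]
  toFun : X → alg
  holds : R.holds alg toFun

attribute [instance] Rep.inst

/-- The `ℓ^∞`-product of the C*-algebras carrying the families that satisfy the relations. -/
abbrev Product : Type (u + 1) := lp (fun π : R.Rep => π.alg) ∞

/-- The family in the product whose `π`-th coordinate is the family `π`. -/
noncomputable def prodGen (x : X) : R.Product :=
  ⟨fun π => π.toFun x, memℓp_infty ⟨1, by
    rintro _ ⟨π, rfl⟩
    exact R.norm_le_one π.alg π.toFun π.holds x⟩⟩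

/-- The C*-subalgebra of the product generated by the family `prodGen`. -/
noncomputable def subalgebra : NonUnitalStarSubalgebra ℂ R.Product :=
  (NonUnitalStarAlgebra.adjoin ℂ (Set.range R.prodGen)).topologicalClosure

/-- The universal C*-algebra generated by a family satisfying the relations. Since it sits in the
product of all such families, the norm of a *-polynomial in the generators is the supremum of its
norms over all families. -/
def Univ : Type (u + 1) := R.subalgebra

noncomputable instance : NonUnitalCStarAlgebra R.Univ :=
  NonUnitalStarSubalgebra.nonUnitalCStarAlgebra R.subalgebra
    (h_closed := NonUnitalStarSubalgebra.isClosed_topologicalClosure _)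

/-- The generators of the universal C*-algebra. -/
noncomputable def gen (x : X) : R.Univ :=
  ⟨R.prodGen x, NonUnitalStarSubalgebra.le_topologicalClosure _
    (NonUnitalStarAlgebra.subset_adjoin ℂ _ ⟨x, rfl⟩)⟩

/-- The `π`-th coordinate, as a *-homomorphism. -/
noncomputable def eval (π : R.Rep) : R.Univ →⋆ₙₐ[ℂ] π.alg where
  toFun a := (a.1 : R.Product) π
  map_smul' _ _ := rfl
  map_zero' := rfl
  map_add' _ _ := rfl
  map_mul' _ _ := rfl
  map_star' _ := rfl

theorem eval_ext {a b : R.Univ} (h : ∀ π, R.eval π a = R.eval π b) : a = b :=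
  Subtype.ext (Subtype.ext (funext h))

/-- *-homomorphisms out of the universal C*-algebra are determined on the generators. -/
theorem hom_ext {B : Type w} [NonUnitalCStarAlgebra B] (φ ψ : R.Univ →⋆ₙₐ[ℂ] B)
    (h : ∀ x, φ (R.gen x) = ψ (R.gen x)) : φ = ψ := by
  have key : ∀ (a : R.Product) (ha : a ∈ NonUnitalStarAlgebra.adjoin ℂ (Set.range R.prodGen)),
      φ (⟨a, NonUnitalStarSubalgebra.le_topologicalClosure _ ha⟩ : R.subalgebra) =
        ψ (⟨a, NonUnitalStarSubalgebra.le_topologicalClosure _ ha⟩ : R.subalgebra) := by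
    intro a ha
    induction ha using NonUnitalStarAlgebra.adjoin_induction with
    | mem x hx => obtain ⟨x, rfl⟩ := hx; exact h x
    | add x y hx hy ihx ihy =>
      exact ((map_add φ _ _).trans (congrArg₂ (· + ·) ihx ihy)).trans (map_add ψ _ _).symm
    | zero => exact (map_zero φ).trans (map_zero ψ).symm
    | mul x y hx hy ihx ihy =>
      exact ((map_mul φ _ _).trans (congrArg₂ (· * ·) ihx ihy)).trans (map_mul ψ _ _).symm
    | smul r x hx ihx =>
      exact ((map_smul φ r _).trans (congrArg (r • ·) ihx)).trans (map_smul ψ r _).symm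
    | star x hx ihx =>
      exact ((map_star φ _).trans (congrArg star ihx)).trans (map_star ψ _).symm
  have hφ : Continuous φ :=
    (NonUnitalStarAlgHom.instContinuousLinearMapClassComplex
      (F := R.Univ →⋆ₙₐ[ℂ] B)).map_continuous φ
  have hψ : Continuous ψ :=
    (NonUnitalStarAlgHom.instContinuousLinearMapClassComplex
      (F := R.Univ →⋆ₙₐ[ℂ] B)).map_continuous ψ
  ext ⟨a, ha⟩
  obtain ⟨b, hb, hlim⟩ := mem_closure_iff_seq_limit.1 ha
  have hlim' : Filter.Tendsto (fun n => (⟨b n,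
      NonUnitalStarSubalgebra.le_topologicalClosure _ (hb n)⟩ : R.subalgebra)) Filter.atTop
      (nhds ⟨a, ha⟩) := tendsto_subtype_rng.2 hlim
  exact tendsto_nhds_unique ((hφ.tendsto _).comp hlim')
    (((hψ.tendsto _).comp hlim').congr fun n => (key _ (hb n)).symm)

/-- The universal property. -/
theorem existsUnique_lift (A : Type u) [NonUnitalCStarAlgebra A] (f : X → A) (hf : R.holds A f) :
    ∃! φ : R.Univ →⋆ₙₐ[ℂ] A, ∀ x, φ (R.gen x) = f x :=
  ⟨R.eval ⟨A, f, hf⟩, fun _ => rfl, fun ψ hψ => R.hom_ext _ _ fun x => by rw [hψ]; rfl⟩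

end CStarRelations

/-- A partial isometry in a C*-algebra is a contraction. -/
theorem norm_le_one_of_partialIsometry {A : Type*} [NonUnitalCStarAlgebra A] {a : A}
    (h : a * star a * a = a) : ‖a‖ ≤ 1 := by
  have h2 : ‖a‖ * ‖a‖ * (‖a‖ * ‖a‖) = ‖a‖ * ‖a‖ := by
    have e : (star a * a) * (star a * a) = star a * a := by
      rw [← mul_assoc, mul_assoc (star a) a (star a), mul_assoc (star a), h]
    have hs : star (star a * a) = star a * a := by simp
    have := CStarRing.norm_star_mul_self (x := star a * a)
    rw [hs, e, CStarRing.norm_star_mul_self] at this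
    exact this.symm
  by_contra! hc
  have h3 : 1 < ‖a‖ * ‖a‖ := by nlinarith
  nlinarith

/-- `q` is the join of the set `P` of projections: the least projection `q` with `p ≤ q` for all
`p ∈ P`, where `p ≤ q` means `p * q = p`. -/
structure IsProjJoin {A : Type*} [NonUnitalCStarAlgebra A] (P : Set A) (q : A) : Prop where
  isStarProjection : IsStarProjection q
  le : ∀ p ∈ P, p * q = p
  least : ∀ q', IsStarProjection q' → (∀ p ∈ P, p * q' = p) → q * q' = q

/-! ### Cuntz–Krieger algebras of small categories

A morphism `μ : v ⟶ w` is read as having range `v` and source `w`, so that `λ ≫ μ` is the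
product `λμ`, defined when `s(λ) = r(μ)`. -/

namespace SmallCat

/-- The set of all morphisms of a small category. -/
abbrev Mor (C : Type u) [SmallCategory C] : Type u := Σ v w : C, (v ⟶ w)

variable {C : Type u} [SmallCategory C]

/-- `Le α β` means `β ∈ αΛ`. -/
inductive Le : Mor C → Mor C → Prop
  | mk {v w x : C} (α : v ⟶ w) (γ : w ⟶ x) : Le ⟨v, w, α⟩ ⟨v, x, α ≫ γ⟩

/-- The common extensions of `α` and `β`, that is, `αΛ ∩ βΛ`. -/
def commonExt (α β : Mor C) : Set (Mor C) := {γ | Le α γ ∧ Le β γ}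

/-- The set `α ∨ β` of minimal common extensions of `α` and `β`. -/
def minCommonExt (α β : Mor C) : Set (Mor C) :=
  {γ | γ ∈ commonExt α β ∧ ¬ ∃ δ ∈ commonExt α β, Le δ γ ∧ ¬ Le γ δ}

/-- `F` is an exhaustive subset of `vΛ`. -/
def IsExhaustive (v : C) (F : Set (Mor C)) : Prop :=
  (∀ β ∈ F, β.1 = v) ∧ ∀ α : Mor C, α.1 = v → ∃ β ∈ F, (commonExt α β).Nonempty

variable (C) in
/-- `αβ = αγ` implies `β = γ`. -/
def IsLeftCancellative : Prop :=
  ∀ ⦃v w x : C⦄ (α : v ⟶ w) (β γ : w ⟶ x), α ≫ β = α ≫ γ → β = γ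

variable (C) in
/-- Every `αΛ ∩ βΛ` is a finite union of sets `γΛ`. -/
def IsFinitelyAligned : Prop :=
  ∀ α β : Mor C, ∃ F : Set (Mor C), F.Finite ∧ commonExt α β = ⋃ γ ∈ F, {δ | Le γ δ}

/-- Cuntz–Krieger families of a finitely aligned left cancellative small category: the relations
`S_μ^* S_μ = S_{s(μ)}`, `S_μ S_ν = S_{μν}`, `S_μ S_μ^* S_ν S_ν^* = ⋁_{ξ ∈ μ ∨ ν} S_ξ S_ξ^*`, and
`S_v = ⋁_{ξ ∈ F} S_ξ S_ξ^*` for finite exhaustive `F ⊆ vΛ`. -/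
structure IsCKFamily {A : Type w} [NonUnitalCStarAlgebra A] (S : Mor C → A) : Prop where
  star_mul_self : ∀ {v w : C} (μ : v ⟶ w), star (S ⟨v, w, μ⟩) * S ⟨v, w, μ⟩ = S ⟨w, w, 𝟙 w⟩
  mul : ∀ {v w x : C} (μ : v ⟶ w) (ν : w ⟶ x),
    S ⟨v, w, μ⟩ * S ⟨w, x, ν⟩ = S ⟨v, x, μ ≫ ν⟩
  join : ∀ μ ν : Mor C, IsProjJoin ((fun ξ => S ξ * star (S ξ)) '' minCommonExt μ ν)
    (S μ * star (S μ) * (S ν * star (S ν)))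
  exhaustive : ∀ (v : C) (F : Set (Mor C)), F.Finite → IsExhaustive v F →
    IsProjJoin ((fun ξ => S ξ * star (S ξ)) '' F) (S ⟨v, v, 𝟙 v⟩)

theorem IsCKFamily.norm_le_one {A : Type w} [NonUnitalCStarAlgebra A] {S : Mor C → A}
    (h : IsCKFamily S) (μ : Mor C) : ‖S μ‖ ≤ 1 := by
  obtain ⟨v, w, μ⟩ := μ
  refine norm_le_one_of_partialIsometry ?_
  rw [mul_assoc, h.star_mul_self, h.mul, Category.comp_id]

variable (C) in
/-- The relations defining the Cuntz–Krieger algebra. -/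
def ckRelations : CStarRelations (Mor C) where
  holds _ _ S := IsCKFamily S
  norm_le_one _ _ _ h := h.norm_le_one

variable (C) in
/-- The Cuntz–Krieger algebra `𝒪(Λ)`. -/
abbrev CuntzKriegerAlgebra : Type (u + 1) := (ckRelations C).Univ

/-- The generator `t_μ` of `𝒪(Λ)`. -/
noncomputable def ckGen {v w : C} (μ : v ⟶ w) : CuntzKriegerAlgebra C :=
  (ckRelations C).gen ⟨v, w, μ⟩

/-- The generators of `𝒪(Λ)` form a Cuntz–Krieger family. -/
theorem isCKFamily_gen : IsCKFamily (ckRelations C).gen := by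
  have join_of {P : Set (Mor C)} {q : (ckRelations C).Univ}
      (hq : ∀ π : (ckRelations C).Rep,
        IsProjJoin ((fun ξ => π.toFun ξ * star (π.toFun ξ)) '' P) ((ckRelations C).eval π q)) :
      IsProjJoin ((fun ξ => (ckRelations C).gen ξ * star ((ckRelations C).gen ξ)) '' P) q := by
    refine ⟨⟨?_, ?_⟩, ?_, fun q' hq' h => ?_⟩
    · exact CStarRelations.eval_ext _ fun π =>
        (map_mul _ _ _).trans (hq π).isStarProjection.isIdempotentElem
    · exact CStarRelations.eval_ext _ fun π =>
        (map_star _ _).trans (hq π).isStarProjection.isSelfAdjoint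
    · rintro _ ⟨ξ, hξ, rfl⟩
      exact CStarRelations.eval_ext _ fun π => (map_mul _ _ _).trans ((hq π).le _ ⟨ξ, hξ, rfl⟩)
    · refine CStarRelations.eval_ext _ fun π =>
        (map_mul _ _ _).trans ((hq π).least _ (hq'.map _) ?_)
      rintro _ ⟨ξ, hξ, rfl⟩
      exact (map_mul ((ckRelations C).eval π) _ _).symm.trans (congrArg _ (h _ ⟨ξ, hξ, rfl⟩))
  exact {
    star_mul_self := fun μ => CStarRelations.eval_ext _ fun π => IsCKFamily.star_mul_self π.holds μ
    mul := fun μ ν => CStarRelations.eval_ext _ fun π => IsCKFamily.mul π.holds μ ν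
    join := fun μ ν => join_of fun π => IsCKFamily.join π.holds μ ν
    exhaustive := fun v F hF h => join_of fun π => IsCKFamily.exhaustive π.holds v F hF h }

end SmallCat

/-! ### Directed graphs of groups -/

/-- A directed graph of groups `𝒢₊ = (Γ₊, G)`. Here `E` is the orientation `Γ₊¹`; the remaining
edges of the underlying undirected graph `Γ` are the reversals `ē` of the `e : E`, with
`r(ē) = s(e)`, `s(ē) = r(e)` and the same edge group. The monomorphism `α_ē` is `αbar e`. -/
structure DirectedGraphOfGroups where
  V : Type u
  E : Type u
  r : E → V
  s : E → V
  G : V → Type u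
  [groupV : ∀ v, Group (G v)]
  Ge : E → Type u
  [groupE : ∀ e, Group (Ge e)]
  α : ∀ e, Ge e →* G (r e)
  αbar : ∀ e, Ge e →* G (s e)
  α_injective : ∀ e, Function.Injective (α e)
  αbar_injective : ∀ e, Function.Injective (αbar e)

namespace DirectedGraphOfGroups

attribute [instance] groupV groupE

variable (𝒢 : DirectedGraphOfGroups.{u})

/-- The vertex set, the edge set and all the groups are countable. -/
structure IsCountable : Prop where
  vertices : Countable 𝒢.V
  edges : Countable 𝒢.E
  groups : ∀ v, Countable (𝒢.G v)

/-- Every vertex receives finitely many edges, and the images of the edge groups in the vertex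
groups at the ranges of the edges have finite index. -/
structure IsRowFinite : Prop where
  edges : ∀ v, {e | 𝒢.r e = v}.Finite
  index : ∀ e, (𝒢.α e).range.FiniteIndex

/-- Every vertex receives an edge. -/
def HasNoSources : Prop := ∀ v, ∃ e, 𝒢.r e = v

/-- A set of transversals: for every `e ∈ Γ₊¹` a set of representatives of the left cosets of
`α_e(G_e)` in `G_{r(e)}` which contains the identity. -/
structure Transversals where
  set : ∀ e, Set (𝒢.G (𝒢.r e))
  isComplement : ∀ e, Subgroup.IsComplement (set e) ((𝒢.α e).range : Set (𝒢.G (𝒢.r e)))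
  one_mem : ∀ e, 1 ∈ set e

/-! #### The fundamental groupoid and the word category -/

/-- The generators of the fundamental groupoid: the edges `e` and `ē` for `e ∈ Γ₊¹`, and the
elements of the vertex groups. An element of `Gen v w` has range `v` and source `w`. -/
inductive Gen : 𝒢.V → 𝒢.V → Type u
  | pos (e : 𝒢.E) : Gen (𝒢.r e) (𝒢.s e)
  | neg (e : 𝒢.E) : Gen (𝒢.s e) (𝒢.r e)
  | elt {v : 𝒢.V} (g : 𝒢.G v) : Gen v v

instance : Quiver 𝒢.V := ⟨𝒢.Gen⟩

/-- The free groupoid on the generators. -/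
def FreeGpd : Type u := Quiver.FreeGroupoid 𝒢.V

instance : Groupoid.{u} 𝒢.FreeGpd := Quiver.FreeGroupoid.instGroupoid

/-- A vertex as an object of the free groupoid. -/
def freeVertex (v : 𝒢.V) : 𝒢.FreeGpd := (Quiver.FreeGroupoid.of 𝒢.V).obj v

/-- A generator as a morphism of the free groupoid. -/
def freeGen {v w : 𝒢.V} (x : 𝒢.Gen v w) : 𝒢.freeVertex v ⟶ 𝒢.freeVertex w :=
  (Quiver.FreeGroupoid.of 𝒢.V).map x

/-- The defining relations of the fundamental groupoid. -/
inductive Rel : ∀ ⦃a b : 𝒢.FreeGpd⦄, (a ⟶ b) → (a ⟶ b) → Prop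
  | mul {v : 𝒢.V} (g h : 𝒢.G v) :
      Rel (𝒢.freeGen (.elt g) ≫ 𝒢.freeGen (.elt h)) (𝒢.freeGen (.elt (g * h)))
  | rev (e : 𝒢.E) : Rel (𝒢.freeGen (.neg e)) (Groupoid.inv (𝒢.freeGen (.pos e)))
  | slide_pos (e : 𝒢.E) (g : 𝒢.Ge e) :
      Rel (𝒢.freeGen (.elt (𝒢.α e g)) ≫ 𝒢.freeGen (.pos e))
        (𝒢.freeGen (.pos e) ≫ 𝒢.freeGen (.elt (𝒢.αbar e g)))
  | slide_neg (e : 𝒢.E) (g : 𝒢.Ge e) :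
      Rel (𝒢.freeGen (.elt (𝒢.αbar e g)) ≫ 𝒢.freeGen (.neg e))
        (𝒢.freeGen (.neg e) ≫ 𝒢.freeGen (.elt (𝒢.α e g)))

/-- The fundamental groupoid `F(𝒢)`. -/
def FundGroupoid : Type u := CategoryTheory.Quotient 𝒢.Rel

noncomputable instance : Groupoid.{u} 𝒢.FundGroupoid := CategoryTheory.Quotient.groupoid 𝒢.Rel

/-- The quotient functor from the free groupoid to the fundamental groupoid. -/
noncomputable def toFund : 𝒢.FreeGpd ⥤ 𝒢.FundGroupoid := CategoryTheory.Quotient.functor 𝒢.Rel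

/-- A vertex as an object of the fundamental groupoid. -/
def vertex (v : 𝒢.V) : 𝒢.FundGroupoid := ⟨𝒢.freeVertex v⟩

/-- A generator as a morphism of the fundamental groupoid. -/
noncomputable def fundGen {v w : 𝒢.V} (x : 𝒢.Gen v w) : 𝒢.vertex v ⟶ 𝒢.vertex w :=
  𝒢.toFund.map (𝒢.freeGen x)

/-- `𝒢₊`-words `g₁ e₁ g₂ e₂ … gₙ eₙ gₙ₊₁` with edges in `Γ₊¹`, by range and source. -/
inductive Word : 𝒢.V → 𝒢.V → Type u
  | elt {v : 𝒢.V} (g : 𝒢.G v) : Word v v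
  | cons (e : 𝒢.E) (g : 𝒢.G (𝒢.r e)) {w : 𝒢.V} (x : Word (𝒢.s e) w) : Word (𝒢.r e) w

/-- The image of a `𝒢₊`-word in the fundamental groupoid. -/
noncomputable def Word.image : ∀ {v w : 𝒢.V}, 𝒢.Word v w → (𝒢.vertex v ⟶ 𝒢.vertex w)
  | _, _, .elt g => 𝒢.fundGen (.elt g)
  | _, _, .cons e g x => 𝒢.fundGen (.elt g) ≫ 𝒢.fundGen (.pos e) ≫ x.image

theorem fundGen_mul {v : 𝒢.V} (g h : 𝒢.G v) :
    𝒢.fundGen (.elt g) ≫ 𝒢.fundGen (.elt h) = 𝒢.fundGen (.elt (g * h)) :=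
  (𝒢.toFund.map_comp _ _).symm.trans (CategoryTheory.Quotient.sound 𝒢.Rel (Rel.mul g h))

theorem fundGen_one (v : 𝒢.V) : 𝒢.fundGen (.elt (1 : 𝒢.G v)) = 𝟙 (𝒢.vertex v) := by
  have h := 𝒢.fundGen_mul (1 : 𝒢.G v) 1
  rw [mul_one] at h
  exact (cancel_epi (𝒢.fundGen (.elt (1 : 𝒢.G v)))).1 (h.trans (Category.comp_id _).symm)

theorem exists_word_comp {v w : 𝒢.V} (x : 𝒢.Word v w) {z : 𝒢.V} (y : 𝒢.Word w z) :
    ∃ t : 𝒢.Word v z, t.image = x.image ≫ y.image := by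
  induction x with
  | elt g =>
    cases y with
    | elt h => exact ⟨.elt (g * h), (𝒢.fundGen_mul g h).symm⟩
    | cons e h y =>
      refine ⟨.cons e (g * h) y, ?_⟩
      simp only [Word.image, ← 𝒢.fundGen_mul, Category.assoc]
  | cons e g x ih =>
    obtain ⟨t, ht⟩ := ih y
    exact ⟨.cons e g t, by simp only [Word.image, ht, Category.assoc]⟩

/-- The word category `Λ_{𝒢₊}`: the subcategory of the fundamental groupoid, with the same
objects, whose morphisms are the images of `𝒢₊`-words. -/
structure WordCategory where
  vert : 𝒢.V

noncomputable instance : SmallCategory 𝒢.WordCategory where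
  Hom a b := {γ : 𝒢.vertex a.vert ⟶ 𝒢.vertex b.vert // ∃ x : 𝒢.Word a.vert b.vert, x.image = γ}
  id a := ⟨𝟙 _, .elt 1, 𝒢.fundGen_one a.vert⟩
  comp γ δ := ⟨γ.1 ≫ δ.1, by
    obtain ⟨x, hx⟩ := γ.2
    obtain ⟨y, hy⟩ := δ.2
    rw [← hx, ← hy]
    exact 𝒢.exists_word_comp x y⟩
  id_comp γ := Subtype.ext (Category.id_comp γ.1)
  comp_id γ := Subtype.ext (Category.comp_id γ.1)
  assoc γ δ ε := Subtype.ext (Category.assoc γ.1 δ.1 ε.1)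

/-- The element of the word category represented by a `𝒢₊`-word. -/
noncomputable def Word.toHom {v w : 𝒢.V} (x : 𝒢.Word v w) :
    (⟨v⟩ : 𝒢.WordCategory) ⟶ ⟨w⟩ :=
  ⟨x.image, x, rfl⟩

/-- The element `1 e 1` of the word category. -/
noncomputable def wordEdge (e : 𝒢.E) : (⟨𝒢.r e⟩ : 𝒢.WordCategory) ⟶ ⟨𝒢.s e⟩ :=
  Word.toHom 𝒢 (.cons e 1 (.elt 1))

/-- The element `g` of the word category, for `g ∈ G_v`. -/
noncomputable def wordElt {v : 𝒢.V} (g : 𝒢.G v) : (⟨v⟩ : 𝒢.WordCategory) ⟶ ⟨v⟩ :=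
  Word.toHom 𝒢 (.elt g)

/-! #### The C*-algebra of a directed graph of groups -/

variable {𝒢}

/-- `(𝒢₊, T)`-families for a row-finite directed graph of groups `𝒢₊` and a set `T` of
transversals (so that the sum in `sum_eq` is finite). -/
structure IsFamily (T : 𝒢.Transversals) {A : Type w} [NonUnitalCStarAlgebra A]
    (S : 𝒢.E → A) (U : ∀ v, 𝒢.G v → A) : Prop where
  partialIsometry : ∀ e, S e * star (S e) * S e = S e
  partialUnitary : ∀ v g, U v g * star (U v g) * U v g = U v g ∧
    star (U v g) * U v g = U v g * star (U v g)
  map_mul : ∀ v g h, U v (g * h) = U v g * U v h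
  orthogonal : ∀ v w, v ≠ w → U v 1 * U w 1 = 0
  slide : ∀ e (g : 𝒢.Ge e), U (𝒢.r e) (𝒢.α e g) * S e = S e * U (𝒢.s e) (𝒢.αbar e g)
  source : ∀ e, U (𝒢.s e) 1 = star (S e) * S e
  sum_eq : ∀ v, U v 1 = ∑ᶠ (e : 𝒢.E) (_ : 𝒢.r e = v) (h : 𝒢.G (𝒢.r e)) (_ : h ∈ T.set e),
    U (𝒢.r e) h * S e * star (S e) * star (U (𝒢.r e) h)

/-- The relations defining `C*(𝒢₊)`, on the generators `s_e` and `u_{v,g}`. -/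
def relations (T : 𝒢.Transversals) : CStarRelations (𝒢.E ⊕ Σ v, 𝒢.G v) where
  holds _ _ f := IsFamily T (fun e => f (.inl e)) (fun v g => f (.inr ⟨v, g⟩))
  norm_le_one _ _ _ h
    | .inl e => norm_le_one_of_partialIsometry (h.partialIsometry e)
    | .inr ⟨v, g⟩ => norm_le_one_of_partialIsometry (h.partialUnitary v g).1

/-- The directed graph of groups C*-algebra `C*(𝒢₊)`, formed with the transversals `T`. -/
abbrev CStar (T : 𝒢.Transversals) : Type (u + 1) := (relations T).Univ

/-- The generator `s_e` of `C*(𝒢₊)`. -/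
noncomputable def sGen (T : 𝒢.Transversals) (e : 𝒢.E) : CStar T :=
  (relations T).gen (.inl e)

/-- The generator `u_{v,g}` of `C*(𝒢₊)`. -/
noncomputable def uGen (T : 𝒢.Transversals) (v : 𝒢.V) (g : 𝒢.G v) : CStar T :=
  (relations T).gen (.inr ⟨v, g⟩)

/-- For a row-finite `𝒢₊`, the generators of `C*(𝒢₊)` form a `(𝒢₊, T)`-family. -/
theorem isFamily_gen (h𝒢 : 𝒢.IsRowFinite) (T : 𝒢.Transversals) :
    IsFamily T (sGen T) (uGen T) where
  partialIsometry e := CStarRelations.eval_ext _ fun π => IsFamily.partialIsometry π.holds e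
  partialUnitary v g :=
    ⟨CStarRelations.eval_ext _ fun π => (IsFamily.partialUnitary π.holds v g).1,
      CStarRelations.eval_ext _ fun π => (IsFamily.partialUnitary π.holds v g).2⟩
  map_mul v g h := CStarRelations.eval_ext _ fun π => IsFamily.map_mul π.holds v g h
  orthogonal v w h := CStarRelations.eval_ext _ fun π => IsFamily.orthogonal π.holds v w h
  slide e g := CStarRelations.eval_ext _ fun π => IsFamily.slide π.holds e g
  source e := CStarRelations.eval_ext _ fun π => IsFamily.source π.holds e
  sum_eq v := CStarRelations.eval_ext _ fun π => by
    have hT (e : 𝒢.E) : (T.set e).Finite :=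
      have := h𝒢.index e
      (T.isComplement e).finite_left
    refine (IsFamily.sum_eq π.holds v).trans ?_
    have key := ((relations T).eval π : (relations T).Univ →+ π.alg).map_finsum_mem
      (fun e => ∑ᶠ (h : 𝒢.G (𝒢.r e)) (_ : h ∈ T.set e),
        uGen T (𝒢.r e) h * sGen T e * star (sGen T e) * star (uGen T (𝒢.r e) h)) (h𝒢.edges v)
    refine Eq.trans ?_ key.symm
    refine finsum_mem_congr rfl fun e _ => Eq.symm ?_
    exact ((relations T).eval π : (relations T).Univ →+ π.alg).map_finsum_mem _ (hT e)

end DirectedGraphOfGroups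

/-! ### Positive words in the fundamental groupoid

The fundamental groupoid acts on sets large enough to separate positive words. -/

/-! The two algebras have the same families. A $(\mathcal G_+,\Sigma)$-family extends to $\Lambda$
by multiplying operators along words (`wordOp`); conversely a Cuntz–Krieger family is restricted to
edges and group elements. These passages are mutually inverse on generators, so what must be shown
is that each yields the relations of the other.

The algebraic core is that two positive words are equal in $F(\mathcal G)$ only through slides
$g\alpha_e(c)\,e\,x = g\,e\,\alpha_{\overline e}(c)x$. This is proved with an action of $F(\mathcal
G)$ on countable sets, in which the image of a base point shows whether a word has edges and, if so,
its first edge and first coset (`act_image_elt`, `act_image_cons`). Cancelling the head in the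
groupoid and inducting gives `Word.congr_of_mor_eq`, which makes `wordOp` well defined on $\Lambda$.

Hence $\Lambda$ is tree-like: two elements are comparable under the prefix preorder or have no
common extension (`le_or_le_or_commonExt_eq_empty`). Finite alignment follows, while left
cancellation is inherited from the groupoid. Relation (S3) reduces to nested or orthogonal range
projections; orthogonality comes from (4), since projections whose sum is a projection are mutually
orthogonal (`mul_eq_zero_of_sum_mul_eq`). Relation (S4) follows by iterating (4) beyond the lengths
of the words in $F$. Conversely, (4) is (S4) for the edges with coset representatives, an exhaustive
set with orthogonal range projections, whose join is a sum. Since $\mathcal O(\Lambda)$ does not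
involve $\Sigma$, independence of the transversals follows. -/

/-- A group is, as a left set over a subgroup, a disjoint union of free orbits. -/
theorem exists_equiv_prod_of_injective {H G : Type*} [Group H] [Group G] (i : H →* G)
    (hi : Function.Injective i) :
    ∃ (R : Set G) (r₀ : R) (φ : G ≃ H × R),
      (∀ c a, φ (i c * a) = (c * (φ a).1, (φ a).2)) ∧ ∀ c, φ.symm (c, r₀) = i c := by
  -- The transversal is taken through 1, so that the orbit labelled `r₀` is the image of `H` itself.
  obtain ⟨R, hR, h1⟩ := i.range.exists_isComplement_right 1
  let f : H × R → G := fun p => i p.1 * p.2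
  have hf : Function.Bijective f := by
    have h2 : Function.Bijective (Prod.map (MonoidHom.ofInjective hi) id : H × R → i.range × R) :=
      (MonoidHom.ofInjective hi).bijective.prodMap Function.bijective_id
    exact hR.comp h2
  refine ⟨R, ⟨1, h1⟩, (Equiv.ofBijective f hf).symm, fun c a => ?_, fun c => ?_⟩
  · rw [Equiv.symm_apply_eq]
    have := (Equiv.ofBijective f hf).apply_symm_apply a
    change i c * a = i (c * _) * _
    rw [map_mul, mul_assoc]
    exact congrArg _ this.symm
  · simp [f]

theorem CategoryTheory.Functor.map_groupoid_inv {C D : Type*} [Groupoid C] [Groupoid D] (F : C ⥤ D)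
    {a b : C} (f : a ⟶ b) : F.map (Groupoid.inv f) = Groupoid.inv (F.map f) := by
  simp [Groupoid.inv_eq_inv]

theorem groupoid_slide_inv {C : Type*} [Groupoid C] {v w : C} {a : v ⟶ v} {b : w ⟶ w} {p : v ⟶ w}
    (h : a ≫ p = p ≫ b) : b ≫ Groupoid.inv p = Groupoid.inv p ≫ a := by
  rw [Groupoid.inv_eq_inv, IsIso.comp_inv_eq, Category.assoc, h, IsIso.inv_hom_id_assoc]

namespace DirectedGraphOfGroups

variable (𝒢 : DirectedGraphOfGroups.{u})

/-! ### The permutation action of the fundamental groupoid -/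

/-- Labels for the orbits of the vertex groups. -/
abbrev Label : Type u := Option 𝒢.E × ℕ × Bool

/-- The set on which the vertex group at `v` acts. -/
abbrev ActSet (v : 𝒢.V) : Type u := 𝒢.G v × 𝒢.Label

variable {𝒢}

/-- `B` will match the free `Ge e`-orbits on the two sides. The flag `true` marks the orbits that
positive words can reach from the base point. The prescribed set, its target and both complements
are countably infinite, so any bijections between corresponding pieces glue: the points flagged
`false` keep the first complement infinite, those labelled `none` the second. -/
theorem exists_label_equiv (h𝒢 : 𝒢.IsCountable) (e : 𝒢.E) {R : Set (𝒢.G (𝒢.s e))}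
    {Q : Set (𝒢.G (𝒢.r e))} (r₀ : R) (q₀ : Q) :
    ∃ B : R × 𝒢.Label ≃ Q × 𝒢.Label,
      ∀ r o n, ∃ m, B (r, (o, n, true)) = (q₀, (some e, m, true)) := by
  classical
  have := h𝒢.edges
  have := h𝒢.groups (𝒢.s e)
  have := h𝒢.groups (𝒢.r e)
  let p : R × 𝒢.Label → Prop := fun x => x.2.2.2 = true
  let q : Q × 𝒢.Label → Prop := fun x => ∃ m, x = (q₀, (some e, m, true))
  have : Infinite {x // p x} :=
    Infinite.of_injective (fun n : ℕ => ⟨(r₀, (none, n, true)), rfl⟩) fun a b h => by simpa using h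
  have : Infinite {x // ¬ p x} :=
    Infinite.of_injective (fun n : ℕ => ⟨(r₀, (none, n, false)), by simp [p]⟩)
      fun a b h => by simpa using h
  have : Infinite {x // q x} :=
    Infinite.of_injective (fun n : ℕ => ⟨(q₀, (some e, n, true)), n, rfl⟩)
      fun a b h => by simpa using h
  have : Infinite {x // ¬ q x} :=
    Infinite.of_injective (fun n : ℕ => ⟨(q₀, (none, n, true)), by simp [q]⟩)
      fun a b h => by simpa using h
  obtain ⟨B₁⟩ := nonempty_equiv_of_countable (α := {x // p x}) (β := {x // q x})
  obtain ⟨B₂⟩ := nonempty_equiv_of_countable (α := {x // ¬ p x}) (β := {x // ¬ q x})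
  refine ⟨(Equiv.sumCompl p).symm.trans ((B₁.sumCongr B₂).trans (Equiv.sumCompl q)),
    fun r o n => ?_⟩
  obtain ⟨m, hm⟩ := (B₁ ⟨(r, (o, n, true)), rfl⟩).2
  refine ⟨m, ?_⟩
  simp only [Equiv.trans_apply]
  rw [Equiv.sumCompl_symm_apply_of_pos (p := p) rfl]
  exact hm

/-- Both sets are disjoint unions of free `Ge e`-orbits; `t` permutes orbits by `B` and fixes the
`Ge e`-coordinate, which makes it equivariant. The orbit of `q₀` is the image of `α e`, so every
flagged point lands in the trivial coset, with label `e` and the flag kept. -/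
theorem exists_edge_equiv (h𝒢 : 𝒢.IsCountable) (e : 𝒢.E) :
    ∃ t : 𝒢.ActSet (𝒢.s e) ≃ 𝒢.ActSet (𝒢.r e),
      (∀ c a, t (𝒢.αbar e c * a.1, a.2) = (𝒢.α e c * (t a).1, (t a).2)) ∧
      ∀ a o n, ∃ c m, t (a, (o, n, true)) = (𝒢.α e c, (some e, m, true)) := by
  obtain ⟨R, r₀, φ, hφ, -⟩ := exists_equiv_prod_of_injective (𝒢.αbar e) (𝒢.αbar_injective e)
  obtain ⟨Q, q₀, ψ, hψ, hψ₀⟩ := exists_equiv_prod_of_injective (𝒢.α e) (𝒢.α_injective e)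
  obtain ⟨B, hB⟩ := exists_label_equiv h𝒢 e r₀ q₀
  have hψ' (c d : 𝒢.Ge e) (q : Q) : ψ.symm (c * d, q) = 𝒢.α e c * ψ.symm (d, q) := by
    rw [Equiv.symm_apply_eq, hψ]; simp
  let t : 𝒢.ActSet (𝒢.s e) ≃ 𝒢.ActSet (𝒢.r e) :=
    (φ.prodCongr (Equiv.refl _)).trans <| (Equiv.prodAssoc _ _ _).trans <|
      ((Equiv.refl _).prodCongr B).trans <| (Equiv.prodAssoc _ _ _).symm.trans <|
        ψ.symm.prodCongr (Equiv.refl _)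
  have ht (a : 𝒢.ActSet (𝒢.s e)) : t a =
      (ψ.symm ((φ a.1).1, (B ((φ a.1).2, a.2)).1), (B ((φ a.1).2, a.2)).2) := rfl
  refine ⟨t, fun c a => ?_, fun a o n => ?_⟩
  · simp only [ht, hφ, hψ']
  · obtain ⟨m, hm⟩ := hB (φ a).2 o n
    exact ⟨(φ a).1, m, by simp only [ht, hm, hψ₀]⟩

/-- The bijection by which an edge acts. -/
noncomputable def edgeEquiv (h𝒢 : 𝒢.IsCountable) (e : 𝒢.E) :
    𝒢.ActSet (𝒢.s e) ≃ 𝒢.ActSet (𝒢.r e) :=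
  (exists_edge_equiv h𝒢 e).choose

variable (𝒢) in
/-- The groupoid of bijections between the sets `ActSet v`. -/
structure ActGpd where
  vert : 𝒢.V

/-- The direction is reversed because a morphism `a ⟶ b` has range `a` and source `b`; thus `γ ≫ δ`
acts as `γ` after `δ`. -/
instance : Groupoid.{u} 𝒢.ActGpd where
  Hom a b := 𝒢.ActSet b.vert ≃ 𝒢.ActSet a.vert
  id _ := Equiv.refl _
  comp f g := g.trans f
  inv f := f.symm
  inv_comp f := f.self_trans_symm
  comp_inv f := f.symm_trans_self

/-- The bijection by which a generator acts. -/
noncomputable def genEquiv (h𝒢 : 𝒢.IsCountable) : ∀ {v w : 𝒢.V}, 𝒢.Gen v w →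
    ((⟨v⟩ : 𝒢.ActGpd) ⟶ ⟨w⟩)
  | _, _, .pos e => edgeEquiv h𝒢 e
  | _, _, .neg e => (edgeEquiv h𝒢 e).symm
  | _, _, .elt g => (Equiv.mulLeft g).prodCongr (Equiv.refl _)

/-- The action of the free groupoid. -/
noncomputable def freeAct (h𝒢 : 𝒢.IsCountable) : 𝒢.FreeGpd ⥤ 𝒢.ActGpd :=
  Quiver.FreeGroupoid.lift
    { obj := fun v => ⟨v⟩
      map := fun x => genEquiv h𝒢 x }

theorem freeAct_map (h𝒢 : 𝒢.IsCountable) {v w : 𝒢.V} (x : 𝒢.Gen v w) :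
    (freeAct h𝒢).map (𝒢.freeGen x) = genEquiv h𝒢 x :=
  Category.id_comp (genEquiv h𝒢 x)

theorem freeAct_rel (h𝒢 : 𝒢.IsCountable) {a b : 𝒢.FreeGpd} (x y : a ⟶ b) (h : 𝒢.Rel x y) :
    (freeAct h𝒢).map x = (freeAct h𝒢).map y := by
  have key (e : 𝒢.E) (c : 𝒢.Ge e) : genEquiv h𝒢 (.elt (𝒢.α e c)) ≫ genEquiv h𝒢 (.pos e) =
      genEquiv h𝒢 (.pos e) ≫ genEquiv h𝒢 (.elt (𝒢.αbar e c)) :=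
    Equiv.ext fun a => ((exists_edge_equiv h𝒢 e).choose_spec.1 c a).symm
  have comp {v w z : 𝒢.V} (x : 𝒢.Gen v w) (y : 𝒢.Gen w z) :
      (freeAct h𝒢).map (𝒢.freeGen x ≫ 𝒢.freeGen y) = genEquiv h𝒢 x ≫ genEquiv h𝒢 y :=
    ((freeAct h𝒢).map_comp _ _).trans
      (congrArg₂ (· ≫ ·) (freeAct_map h𝒢 x) (freeAct_map h𝒢 y))
  have neg (e : 𝒢.E) : genEquiv h𝒢 (.neg e) = Groupoid.inv (genEquiv h𝒢 (.pos e)) := rfl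
  cases h with
  | mul g h =>
    refine (comp _ _).trans (Eq.trans ?_ (freeAct_map h𝒢 _).symm)
    exact Equiv.ext fun a => Prod.ext (mul_assoc _ _ _).symm rfl
  | rev e =>
    exact (freeAct_map h𝒢 _).trans ((neg e).trans ((congrArg Groupoid.inv
      (freeAct_map h𝒢 (.pos e))).symm.trans ((freeAct h𝒢).map_groupoid_inv _).symm))
  | slide_pos e c => exact (comp _ _).trans ((key e c).trans (comp _ _).symm)
  | slide_neg e c =>
    exact (comp _ _).trans ((groupoid_slide_inv (key e c)).trans (comp (.neg e) _).symm)

/-- The action of the fundamental groupoid. -/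
noncomputable def fundAct (h𝒢 : 𝒢.IsCountable) : 𝒢.FundGroupoid ⥤ 𝒢.ActGpd :=
  CategoryTheory.Quotient.lift 𝒢.Rel (freeAct h𝒢) fun _ _ x y h => freeAct_rel h𝒢 x y h

theorem fundAct_map (h𝒢 : 𝒢.IsCountable) {v w : 𝒢.V} (x : 𝒢.Gen v w) :
    (fundAct h𝒢).map (𝒢.fundGen x) = genEquiv h𝒢 x :=
  freeAct_map h𝒢 x

/-- The bijection by which an element of the fundamental groupoid acts. -/
noncomputable def act (h𝒢 : 𝒢.IsCountable) {v w : 𝒢.V} (γ : 𝒢.vertex v ⟶ 𝒢.vertex w) :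
    𝒢.ActSet w ≃ 𝒢.ActSet v :=
  (fundAct h𝒢).map γ

theorem act_comp (h𝒢 : 𝒢.IsCountable) {v w z : 𝒢.V} (γ : 𝒢.vertex v ⟶ 𝒢.vertex w)
    (δ : 𝒢.vertex w ⟶ 𝒢.vertex z) (a : 𝒢.ActSet z) :
    act h𝒢 (γ ≫ δ) a = act h𝒢 γ (act h𝒢 δ a) :=
  congrArg (fun t : 𝒢.ActSet z ≃ 𝒢.ActSet v => t a) ((fundAct h𝒢).map_comp γ δ)

theorem act_elt (h𝒢 : 𝒢.IsCountable) {v : 𝒢.V} (g : 𝒢.G v) (a : 𝒢.ActSet v) :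
    act h𝒢 (𝒢.fundGen (.elt g)) a = (g * a.1, a.2) :=
  congrArg (fun t : 𝒢.ActSet v ≃ 𝒢.ActSet v => t a) (fundAct_map h𝒢 (.elt g))

theorem act_pos (h𝒢 : 𝒢.IsCountable) (e : 𝒢.E) (a : 𝒢.ActSet (𝒢.s e)) :
    act h𝒢 (𝒢.fundGen (.pos e)) a = edgeEquiv h𝒢 e a :=
  congrArg (fun t : 𝒢.ActSet (𝒢.s e) ≃ 𝒢.ActSet (𝒢.r e) => t a) (fundAct_map h𝒢 (.pos e))

variable (𝒢) in
/-- The base point of the set `ActSet v`. -/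
def actBase (v : 𝒢.V) : 𝒢.ActSet v := (1, (none, 0, true))

theorem act_image_elt (h𝒢 : 𝒢.IsCountable) {v : 𝒢.V} (g : 𝒢.G v) :
    act h𝒢 (Word.image 𝒢 (.elt g)) (𝒢.actBase v) = (g, (none, 0, true)) :=
  (act_elt h𝒢 g _).trans (Prod.ext (mul_one g) rfl)

/-- The tail only has to reach some flagged point: applying `e` then forgets everything but a coset,
and `g` translates it. The output is flagged again, which drives the induction in `act_image`. -/
theorem act_cons (h𝒢 : 𝒢.IsCountable) (e : 𝒢.E) (g : 𝒢.G (𝒢.r e)) {w : 𝒢.V}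
    (x : 𝒢.Word (𝒢.s e) w) {b : 𝒢.ActSet w} {a o n}
    (hx : act h𝒢 x.image b = (a, (o, n, true))) :
    ∃ c m, act h𝒢 (Word.image 𝒢 (.cons e g x)) b = (g * 𝒢.α e c, (some e, m, true)) := by
  obtain ⟨c, m, hc⟩ := (exists_edge_equiv h𝒢 e).choose_spec.2 a o n
  refine ⟨c, m, ?_⟩
  rw [Word.image, act_comp, act_comp, hx, act_pos, act_elt, edgeEquiv, hc]

theorem act_image (h𝒢 : 𝒢.IsCountable) {v w : 𝒢.V} (x : 𝒢.Word v w) :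
    ∃ a o n, act h𝒢 x.image (𝒢.actBase w) = (a, (o, n, true)) := by
  induction x with
  | elt g => exact ⟨_, _, _, act_image_elt h𝒢 g⟩
  | cons e g x ih =>
    obtain ⟨a, o, n, ha⟩ := ih
    obtain ⟨c, m, hc⟩ := act_cons h𝒢 e g x ha
    exact ⟨_, _, _, hc⟩

theorem act_image_cons (h𝒢 : 𝒢.IsCountable) (e : 𝒢.E) (g : 𝒢.G (𝒢.r e)) {w : 𝒢.V}
    (x : 𝒢.Word (𝒢.s e) w) : ∃ c m,
      act h𝒢 (Word.image 𝒢 (.cons e g x)) (𝒢.actBase w) = (g * 𝒢.α e c, (some e, m, true)) := by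
  obtain ⟨a, o, n, ha⟩ := act_image h𝒢 x
  exact act_cons h𝒢 e g x ha

/-- The morphism of the word category represented by a word. -/
noncomputable def Word.mor {v w : 𝒢.V} (x : 𝒢.Word v w) : SmallCat.Mor 𝒢.WordCategory :=
  ⟨⟨v⟩, ⟨w⟩, Word.toHom 𝒢 x⟩

/-- The point to which a morphism of the word category moves the base point. -/
noncomputable def actPoint (h𝒢 : 𝒢.IsCountable) (m : SmallCat.Mor 𝒢.WordCategory) :
    Σ v, 𝒢.ActSet v :=
  ⟨m.1.vert, act h𝒢 m.2.2.1 (𝒢.actBase m.2.1.vert)⟩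

theorem actPoint_elt (h𝒢 : 𝒢.IsCountable) {v : 𝒢.V} (g : 𝒢.G v) :
    actPoint h𝒢 (Word.mor (.elt g)) = ⟨v, (g, (none, 0, true))⟩ :=
  congrArg (Sigma.mk v) (act_image_elt h𝒢 g)

theorem actPoint_cons (h𝒢 : 𝒢.IsCountable) (e : 𝒢.E) (g : 𝒢.G (𝒢.r e)) {w : 𝒢.V}
    (x : 𝒢.Word (𝒢.s e) w) : ∃ c m,
      actPoint h𝒢 (Word.mor (.cons e g x)) = ⟨𝒢.r e, (g * 𝒢.α e c, (some e, m, true))⟩ := by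
  obtain ⟨c, m, h⟩ := act_image_cons h𝒢 e g x
  exact ⟨c, m, congrArg (Sigma.mk (𝒢.r e)) h⟩

/-! ### Equality of positive words -/

/-- Two pairs of an edge and an element of the vertex group at its range lie in the same coset. -/
def SameCoset (p q : Σ e, 𝒢.G (𝒢.r e)) : Prop := ∃ c, q = ⟨p.1, p.2 * 𝒢.α p.1 c⟩

theorem elt_mor_injective (h𝒢 : 𝒢.IsCountable) {v w : 𝒢.V} {g : 𝒢.G v} {h : 𝒢.G w}
    (hgh : Word.mor (.elt g) = Word.mor (.elt h)) :
    (⟨v, g⟩ : Σ v, 𝒢.G v) = ⟨w, h⟩ := by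
  have := congrArg (actPoint h𝒢) hgh
  rw [actPoint_elt, actPoint_elt] at this
  exact congrArg (fun p : Σ v, 𝒢.ActSet v => (⟨p.1, p.2.1⟩ : Σ v, 𝒢.G v)) this

/-- The base point keeps its label `none` under a group element, whereas a word with an edge gives
it the label `some e`. -/
theorem elt_mor_ne_cons_mor (h𝒢 : 𝒢.IsCountable) {v w : 𝒢.V} (g : 𝒢.G v) (e : 𝒢.E)
    (h : 𝒢.G (𝒢.r e)) (x : 𝒢.Word (𝒢.s e) w) :
    Word.mor (.elt g) ≠ Word.mor (.cons e h x) := by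
  intro hgh
  have := congrArg (actPoint h𝒢) hgh
  obtain ⟨c, m, hc⟩ := actPoint_cons h𝒢 e h x
  rw [actPoint_elt, hc] at this
  simpa using congrArg (fun p : Σ v, 𝒢.ActSet v => p.2.2.1) this

theorem sameCoset_of_cons_mor_eq (h𝒢 : 𝒢.IsCountable) {w z : 𝒢.V} {e f : 𝒢.E} {g : 𝒢.G (𝒢.r e)}
    {h : 𝒢.G (𝒢.r f)} {x : 𝒢.Word (𝒢.s e) w} {y : 𝒢.Word (𝒢.s f) z}
    (hxy : Word.mor (.cons e g x) = Word.mor (.cons f h y)) :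
    SameCoset (⟨e, g⟩ : Σ e, 𝒢.G (𝒢.r e)) ⟨f, h⟩ := by
  have := congrArg (actPoint h𝒢) hxy
  obtain ⟨c, m, hc⟩ := actPoint_cons h𝒢 e g x
  obtain ⟨d, n, hd⟩ := actPoint_cons h𝒢 f h y
  rw [hc, hd] at this
  have hef := congrArg (fun p : Σ v, 𝒢.ActSet v => p.2.2.1) this
  obtain rfl : e = f := by simpa using hef
  have h1 : g * 𝒢.α e c = h * 𝒢.α e d :=
    congrArg Prod.fst (eq_of_heq (Sigma.mk.inj this).2)
  refine ⟨c * d⁻¹, ?_⟩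
  rw [map_mul, map_inv, ← mul_assoc, h1, mul_inv_cancel_right]

end DirectedGraphOfGroups

/-! ### The word category -/

namespace DirectedGraphOfGroups

variable {𝒢 : DirectedGraphOfGroups.{u}}

open SmallCat

/-- Left multiplication of a word by an element of a vertex group. -/
def Word.smul : ∀ {v w : 𝒢.V}, 𝒢.Word v w → 𝒢.G v → 𝒢.Word v w
  | _, _, .elt h, g => .elt (g * h)
  | _, _, .cons e h x, g => .cons e (g * h) x

/-- The product of two words. -/
def Word.comp : ∀ {v w z : 𝒢.V}, 𝒢.Word v w → 𝒢.Word w z → 𝒢.Word v z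
  | _, _, _, .elt g, y => y.smul g
  | _, _, _, .cons e g x, y => .cons e g (x.comp y)

/-- The number of edges in a word. -/
def Word.length : ∀ {v w : 𝒢.V}, 𝒢.Word v w → ℕ
  | _, _, .elt _ => 0
  | _, _, .cons _ _ x => x.length + 1

theorem Word.image_smul {v w : 𝒢.V} (g : 𝒢.G v) (x : 𝒢.Word v w) :
    (x.smul g).image = 𝒢.fundGen (.elt g) ≫ x.image := by
  cases x with
  | elt h => exact (𝒢.fundGen_mul g h).symm
  | cons e h x => simp only [Word.smul, Word.image, ← 𝒢.fundGen_mul, Category.assoc]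

theorem Word.image_comp {v w z : 𝒢.V} (x : 𝒢.Word v w) (y : 𝒢.Word w z) :
    (x.comp y).image = x.image ≫ y.image := by
  induction x with
  | elt g => exact Word.image_smul g y
  | cons e g x ih => simp only [Word.comp, Word.image, ih, Category.assoc]

theorem Word.length_smul {v w : 𝒢.V} (g : 𝒢.G v) (x : 𝒢.Word v w) :
    (x.smul g).length = x.length := by
  cases x <;> rfl

theorem Word.length_comp {v w z : 𝒢.V} (x : 𝒢.Word v w) (y : 𝒢.Word w z) :
    (x.comp y).length = x.length + y.length := by
  induction x with
  | elt g => simp [Word.comp, Word.length, Word.length_smul]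
  | cons e g x ih => simp only [Word.comp, Word.length, ih]; omega

theorem fundGen_slide (e : 𝒢.E) (c : 𝒢.Ge e) :
    𝒢.fundGen (.elt (𝒢.α e c)) ≫ 𝒢.fundGen (.pos e) =
      𝒢.fundGen (.pos e) ≫ 𝒢.fundGen (.elt (𝒢.αbar e c)) :=
  (𝒢.toFund.map_comp _ _).symm.trans
    ((CategoryTheory.Quotient.sound 𝒢.Rel (Rel.slide_pos e c)).trans (𝒢.toFund.map_comp _ _))

theorem Word.image_cons_mul (e : 𝒢.E) (g : 𝒢.G (𝒢.r e)) (c : 𝒢.Ge e) {w : 𝒢.V}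
    (x : 𝒢.Word (𝒢.s e) w) : Word.image 𝒢 (.cons e (g * 𝒢.α e c) x) =
      Word.image 𝒢 (.cons e g (x.smul (𝒢.αbar e c))) := by
  rw [Word.image, Word.image, Word.image_smul, ← fundGen_mul, Category.assoc,
    reassoc_of% fundGen_slide e c]

theorem Word.mor_eq_iff {v w : 𝒢.V} {x y : 𝒢.Word v w} : x.mor = y.mor ↔ x.image = y.image := by
  refine ⟨fun h => ?_, fun h => ?_⟩
  · have h2 := eq_of_heq (Sigma.mk.inj (eq_of_heq (Sigma.mk.inj h).2)).2
    exact congrArg Subtype.val h2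
  · exact congrArg (fun γ => (⟨⟨v⟩, ⟨w⟩, γ⟩ : Mor 𝒢.WordCategory)) (Subtype.ext h)

theorem Word.mor_cons_mul (e : 𝒢.E) (g : 𝒢.G (𝒢.r e)) (c : 𝒢.Ge e) {w : 𝒢.V}
    (x : 𝒢.Word (𝒢.s e) w) : Word.mor (.cons e (g * 𝒢.α e c) x) =
      Word.mor (.cons e g (x.smul (𝒢.αbar e c))) :=
  Word.mor_eq_iff.2 (Word.image_cons_mul e g c x)

theorem Word.mor_cons_cancel {e : 𝒢.E} {g : 𝒢.G (𝒢.r e)} {w z : 𝒢.V} {x : 𝒢.Word (𝒢.s e) w}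
    {y : 𝒢.Word (𝒢.s e) z} (h : Word.mor (.cons e g x) = Word.mor (.cons e g y)) :
    x.mor = y.mor := by
  obtain rfl : w = z := congrArg (fun m : Mor 𝒢.WordCategory => m.2.1.vert) h
  rw [Word.mor_eq_iff, Word.image, Word.image, cancel_epi, cancel_epi] at h
  exact Word.mor_eq_iff.2 h

theorem Word.exists_mor_eq (m : Mor 𝒢.WordCategory) :
    ∃ x : 𝒢.Word m.1.vert m.2.1.vert, x.mor = m := by
  obtain ⟨⟨v⟩, ⟨w⟩, γ, x, rfl⟩ := m
  exact ⟨x, rfl⟩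

/-- A function on words which is compatible with the slide relations depends only on the
element of the word category. -/
theorem Word.congr_of_mor_eq (h𝒢 : 𝒢.IsCountable) {B : Type*} (Φ : ∀ {v w : 𝒢.V}, 𝒢.Word v w → B)
    (hΦ : ∀ (e : 𝒢.E) (g : 𝒢.G (𝒢.r e)) (c : 𝒢.Ge e) {w z : 𝒢.V} (x : 𝒢.Word (𝒢.s e) w)
      (y : 𝒢.Word (𝒢.s e) z), Φ x = Φ (y.smul (𝒢.αbar e c)) →
        Φ (.cons e g x) = Φ (.cons e (g * 𝒢.α e c) y))
    {v w : 𝒢.V} (x : 𝒢.Word v w) {v' w' : 𝒢.V} (y : 𝒢.Word v' w') (h : x.mor = y.mor) :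
    Φ x = Φ y := by
  induction x generalizing v' w' with
  | elt g =>
    cases y with
    | elt g' =>
      have := elt_mor_injective h𝒢 h
      obtain ⟨rfl, h2⟩ := Sigma.mk.inj this
      rw [eq_of_heq h2]
    | cons f g' y => exact absurd h (elt_mor_ne_cons_mor h𝒢 _ _ _ _)
  | cons e g x ih =>
    cases y with
    | elt g' => exact absurd h.symm (elt_mor_ne_cons_mor h𝒢 _ _ _ _)
    | cons f g' y =>
      obtain ⟨c, hc⟩ := sameCoset_of_cons_mor_eq h𝒢 h
      obtain ⟨rfl, h2⟩ := Sigma.mk.inj hc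
      obtain rfl := eq_of_heq h2
      -- Sliding `c` to the right gives both words the same head, which can then be cancelled.
      rw [Word.mor_cons_mul] at h
      exact hΦ f g c x y (ih _ (Word.mor_cons_cancel h))

theorem Word.length_eq_of_mor_eq (h𝒢 : 𝒢.IsCountable) {v w v' w' : 𝒢.V} {x : 𝒢.Word v w}
    {y : 𝒢.Word v' w'} (h : x.mor = y.mor) : x.length = y.length :=
  Word.congr_of_mor_eq h𝒢 Word.length (fun e g c _ _ x y hxy => by
    rw [Word.length_smul] at hxy
    simp only [Word.length, hxy]) x y h

theorem Word.le_mor_iff {v w : 𝒢.V} {x : 𝒢.Word v w} {m : Mor 𝒢.WordCategory} :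
    Le x.mor m ↔ ∃ (z : 𝒢.V) (t : 𝒢.Word w z), m = (x.comp t).mor := by
  refine ⟨fun h => ?_, ?_⟩
  · generalize hn : x.mor = n at h
    cases h with
    | mk α γ =>
      obtain ⟨rfl, h2⟩ := Sigma.mk.inj hn
      obtain ⟨rfl, h3⟩ := Sigma.mk.inj (eq_of_heq h2)
      obtain rfl := eq_of_heq h3
      obtain ⟨γ, t, rfl⟩ := γ
      exact ⟨_, t, congrArg (fun γ => (⟨_, _, γ⟩ : Mor 𝒢.WordCategory))
        (Subtype.ext (Word.image_comp x t).symm)⟩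
  · rintro ⟨z, t, rfl⟩
    have h : (x.comp t).mor = ⟨⟨v⟩, ⟨z⟩, Word.toHom 𝒢 x ≫ Word.toHom 𝒢 t⟩ :=
      congrArg (fun γ => (⟨_, _, γ⟩ : Mor 𝒢.WordCategory)) (Subtype.ext (Word.image_comp x t))
    rw [h]
    exact Le.mk _ _

/-! ### Prefixes, divergence and finite alignment -/

/-- Two words begin with different vertices, or with different cosets after a common prefix. -/
inductive Word.Diverge : ∀ {v w v' w' : 𝒢.V}, 𝒢.Word v w → 𝒢.Word v' w' → Prop
  | vertex {v w v' w' : 𝒢.V} (x : 𝒢.Word v w) (y : 𝒢.Word v' w') (h : v ≠ v') : Diverge x y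
  | head {e f : 𝒢.E} {g : 𝒢.G (𝒢.r e)} {h : 𝒢.G (𝒢.r f)} {w w' : 𝒢.V} (x : 𝒢.Word (𝒢.s e) w)
      (y : 𝒢.Word (𝒢.s f) w') (hc : ¬ SameCoset (⟨e, g⟩ : Σ e, 𝒢.G (𝒢.r e)) ⟨f, h⟩) :
      Diverge (.cons e g x) (.cons f h y)
  | tail {e : 𝒢.E} (g : 𝒢.G (𝒢.r e)) (c : 𝒢.Ge e) {w w' : 𝒢.V} (x : 𝒢.Word (𝒢.s e) w)
      (y : 𝒢.Word (𝒢.s e) w') (h : Diverge x (y.smul (𝒢.αbar e c))) :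
      Diverge (.cons e g x) (.cons e (g * 𝒢.α e c) y)

/-- Group elements are invertible in the word category; for this reason `Le` is only a preorder. -/
theorem Word.le_mor_of_elt {v w : 𝒢.V} (g : 𝒢.G v) (x : 𝒢.Word v w) :
    Le (Word.mor (.elt g)) x.mor := by
  refine Word.le_mor_iff.2 ⟨w, x.smul g⁻¹, Word.mor_eq_iff.2 ?_⟩
  rw [Word.image_comp, Word.image_smul, Word.image, ← Category.assoc, fundGen_mul, mul_inv_cancel,
    fundGen_one, Category.id_comp]

theorem Word.le_mor_cons {e : 𝒢.E} (g : 𝒢.G (𝒢.r e)) {w w' : 𝒢.V} {x : 𝒢.Word (𝒢.s e) w}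
    {y : 𝒢.Word (𝒢.s e) w'} (h : Le x.mor y.mor) :
    Le (Word.mor (.cons e g x)) (Word.mor (.cons e g y)) := by
  obtain ⟨z, t, ht⟩ := Word.le_mor_iff.1 h
  obtain rfl : w' = z := congrArg (fun m : Mor 𝒢.WordCategory => m.2.1.vert) ht
  refine Word.le_mor_iff.2 ⟨_, t, Word.mor_eq_iff.2 ?_⟩
  rw [Word.comp, Word.image, Word.image, Word.mor_eq_iff.1 ht]

/-- If the first cosets agree, a slide makes the heads equal and the comparison passes to the tails;
otherwise the words diverge at once. -/
theorem Word.le_or_le_or_diverge {v w v' w' : 𝒢.V} (x : 𝒢.Word v w) (y : 𝒢.Word v' w') :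
    Le x.mor y.mor ∨ Le y.mor x.mor ∨ Word.Diverge x y := by
  induction x generalizing v' w' with
  | @elt v g =>
    by_cases h : v = v'
    · subst h
      exact .inl (Word.le_mor_of_elt g y)
    · exact .inr (.inr (.vertex _ _ h))
  | cons e g x ih =>
    cases y with
    | elt g' =>
      by_cases h : 𝒢.r e = v'
      · subst h
        exact .inr (.inl (Word.le_mor_of_elt g' _))
      · exact .inr (.inr (.vertex _ _ h))
    | cons f g' y =>
      by_cases h : SameCoset (⟨e, g⟩ : Σ e, 𝒢.G (𝒢.r e)) ⟨f, g'⟩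
      · obtain ⟨c, hc⟩ := h
        obtain ⟨rfl, h2⟩ := Sigma.mk.inj hc
        obtain rfl := eq_of_heq h2
        obtain h | h | h := ih (y.smul (𝒢.αbar f c))
        · exact .inl (Word.mor_cons_mul f g c y ▸ Word.le_mor_cons g h)
        · exact .inr (.inl (Word.mor_cons_mul f g c y ▸ Word.le_mor_cons g h))
        · exact .inr (.inr (.tail g c x y h))
      · exact .inr (.inr (.head x y h))

theorem Word.comp_smul {v w z : 𝒢.V} (g : 𝒢.G v) (x : 𝒢.Word v w) (t : 𝒢.Word w z) :
    ((x.smul g).comp t).image = ((x.comp t).smul g).image := by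
  simp only [Word.image_comp, Word.image_smul, Category.assoc]

/-- Extending a word on the right keeps its first coset, and equal elements have the same first
coset; a common head is cancelled first. -/
theorem Word.Diverge.commonExt_eq_empty (h𝒢 : 𝒢.IsCountable) {v w v' w' : 𝒢.V} {x : 𝒢.Word v w}
    {y : 𝒢.Word v' w'} (h : Word.Diverge x y) : commonExt x.mor y.mor = ∅ := by
  refine Set.eq_empty_of_forall_notMem ?_
  rintro m ⟨hx, hy⟩
  obtain ⟨z, t, rfl⟩ := Word.le_mor_iff.1 hx
  obtain ⟨z', t', ht⟩ := Word.le_mor_iff.1 hy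
  clear hx hy
  induction h generalizing z z' with
  | vertex x y h => exact h (congrArg (fun m : Mor 𝒢.WordCategory => m.1.vert) ht)
  | head x y hc => exact hc (sameCoset_of_cons_mor_eq h𝒢 ht)
  | tail g c x y h ih =>
    rw [Word.comp, Word.comp, Word.mor_cons_mul] at ht
    exact ih _ t _ t' ((Word.mor_cons_cancel ht).trans
      (Word.mor_eq_iff.2 (Word.comp_smul _ _ _).symm))

theorem mor_le_refl (m : Mor 𝒢.WordCategory) : Le m m := by
  obtain ⟨a, b, γ⟩ := m
  simpa using Le.mk γ (𝟙 b)

theorem mor_le_trans {m n p : Mor 𝒢.WordCategory} (h : Le m n) (h' : Le n p) : Le m p := by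
  cases h with
  | mk α β => cases h' with
    | mk _ γ => rw [Category.assoc]; exact Le.mk _ _

theorem le_or_le_or_commonExt_eq_empty (h𝒢 : 𝒢.IsCountable) (m n : Mor 𝒢.WordCategory) :
    Le m n ∨ Le n m ∨ commonExt m n = ∅ := by
  obtain ⟨x, hx⟩ := Word.exists_mor_eq m
  obtain ⟨y, hy⟩ := Word.exists_mor_eq n
  rw [← hx, ← hy]
  exact (Word.le_or_le_or_diverge x y).imp_right (.imp_right (·.commonExt_eq_empty h𝒢))

variable (𝒢) in
theorem isLeftCancellative_wordCategory : IsLeftCancellative 𝒢.WordCategory := by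
  intro v w x α β γ h
  refine Subtype.ext ?_
  have h2 : α.1 ≫ β.1 = α.1 ≫ γ.1 := congrArg Subtype.val h
  exact (cancel_epi α.1).1 h2

theorem isFinitelyAligned_wordCategory (h𝒢 : 𝒢.IsCountable) :
    IsFinitelyAligned 𝒢.WordCategory := by
  intro m n
  obtain h | h | h := le_or_le_or_commonExt_eq_empty h𝒢 m n
  · refine ⟨{n}, Set.finite_singleton n, ?_⟩
    ext p
    simp only [commonExt, Set.mem_ofPred_eq, Set.mem_singleton_iff, Set.iUnion_iUnion_eq_left]
    exact ⟨And.right, fun hp => ⟨mor_le_trans h hp, hp⟩⟩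
  · refine ⟨{m}, Set.finite_singleton m, ?_⟩
    ext p
    simp only [commonExt, Set.mem_ofPred_eq, Set.mem_singleton_iff, Set.iUnion_iUnion_eq_left]
    exact ⟨And.left, fun hp => ⟨hp, mor_le_trans h hp⟩⟩
  · exact ⟨∅, Set.finite_empty, by simpa using h⟩

end DirectedGraphOfGroups

/-! ### Projections in C*-algebras -/

section Projections

variable {A : Type w} [NonUnitalCStarAlgebra A]

theorem isStarProjection_of_partialUnitary {a : A} (h : a * a = a) (h1 : a * star a * a = a)
    (h2 : star a * a = a * star a) : IsStarProjection a := by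
  have h3 : a * star a = a := by
    conv_rhs => rw [← h1, mul_assoc, h2, ← mul_assoc, h]
  refine ⟨h, ?_⟩
  have := congrArg star h3
  rw [star_mul, star_star, h3] at this
  exact this.symm

theorem IsStarProjection.mul_eq_left_comm {p q : A} (hp : IsStarProjection p)
    (hq : IsStarProjection q) (h : p * q = p) : q * p = p := by
  have := congrArg star h
  rwa [star_mul, hp.isSelfAdjoint.star_eq, hq.isSelfAdjoint.star_eq] at this

theorem IsStarProjection.mul_eq_right_comm {p q : A} (hp : IsStarProjection p)
    (hq : IsStarProjection q) (h : q * p = p) : p * q = p := by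
  have := congrArg star h
  rwa [star_mul, hp.isSelfAdjoint.star_eq, hq.isSelfAdjoint.star_eq] at this

/-- Projections whose sum dominates each of them are mutually orthogonal. -/
theorem mul_eq_zero_of_sum_mul_eq {ι : Type*} {s : Finset ι} {P : ι → A}
    (hP : ∀ i ∈ s, IsStarProjection (P i)) (h : ∀ j ∈ s, (∑ i ∈ s, P i) * P j = P j) {i j : ι}
    (hi : i ∈ s) (hj : j ∈ s) (hij : i ≠ j) : P i * P j = 0 := by
  classical
  let _ := CStarAlgebra.spectralOrder A
  have := CStarAlgebra.spectralOrderedRing A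
  have key (k) (hk : k ∈ s) : star (P k * P j) * (P k * P j) = P j * P k * P j := by
    rw [star_mul, (hP k hk).isSelfAdjoint.star_eq, (hP j hj).isSelfAdjoint.star_eq, mul_assoc,
      ← mul_assoc (P k) (P k), (hP k hk).isIdempotentElem, mul_assoc]
  -- The term with `k = j` is already `P j`, so the remaining positive terms sum to zero and each of
  -- them vanishes.
  have h1 : ∑ k ∈ s, star (P k * P j) * (P k * P j) = P j := by
    rw [Finset.sum_congr rfl key, ← Finset.sum_mul, ← Finset.mul_sum, mul_assoc, h j hj,
      (hP j hj).isIdempotentElem]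
  rw [← Finset.add_sum_erase s _ hj, key j hj, (hP j hj).isIdempotentElem,
    (hP j hj).isIdempotentElem, add_eq_left,
    Finset.sum_eq_zero_iff_of_nonneg fun k _ => star_mul_self_nonneg _] at h1
  exact (CStarRing.star_mul_self_eq_zero_iff _).1 (h1 i (Finset.mem_erase.2 ⟨hij, hi⟩))

theorem isStarProjection_mul_star {a : A} (h : a * star a * a = a) :
    IsStarProjection (a * star a) := by
  refine ⟨?_, ?_⟩
  · rw [IsIdempotentElem, ← mul_assoc, h]
  · rw [IsSelfAdjoint, star_mul, star_star]

theorem star_mul_eq_zero_of_range_mul_eq_zero {a b : A} (ha : a * star a * a = a)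
    (hb : b * star b * b = b) (h : (a * star a) * (b * star b) = 0) : star a * b = 0 := by
  have h1 : star a * (a * star a) = star a := by
    have := congrArg star ha
    simpa [mul_assoc] using this
  calc star a * b = star a * (a * star a) * (b * star b * b) := by rw [h1, hb]
    _ = star a * ((a * star a) * (b * star b)) * b := by simp only [mul_assoc]
    _ = 0 := by rw [h, mul_zero, zero_mul]

theorem IsProjJoin.of_mem {P : Set A} {q : A} (hq : IsStarProjection q) (hqP : q ∈ P)
    (h : ∀ p ∈ P, p * q = p) : IsProjJoin P q :=
  ⟨hq, h, fun _ _ h' => h' q hqP⟩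

theorem isProjJoin_empty : IsProjJoin (∅ : Set A) 0 :=
  ⟨⟨mul_zero 0, star_zero A⟩, by simp, fun _ _ _ => zero_mul _⟩

theorem IsProjJoin.eq_zero {q : A} (h : IsProjJoin (∅ : Set A) q) : q = 0 := by
  have := h.least 0 ⟨mul_zero 0, star_zero A⟩ (by simp)
  rwa [mul_zero, eq_comm] at this

/-- The join of finitely many mutually orthogonal projections is their sum. -/
theorem IsProjJoin.eq_sum {ι : Type*} {s : Finset ι} {P : ι → A} {q : A}
    (hq : IsProjJoin (P '' s) q) (hP : ∀ i ∈ s, IsStarProjection (P i))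
    (h : ∀ i ∈ s, ∀ j ∈ s, i ≠ j → P i * P j = 0) : q = ∑ i ∈ s, P i := by
  classical
  have h1 (i) (hi : i ∈ s) : P i * ∑ j ∈ s, P j = P i := by
    rw [Finset.mul_sum, Finset.sum_eq_single i (fun j hj hji => h i hi j hj hji.symm)
      (fun hi' => absurd hi hi'), (hP i hi).isIdempotentElem]
  have h2 : IsStarProjection (∑ i ∈ s, P i) := by
    refine ⟨?_, ?_⟩
    · rw [IsIdempotentElem, Finset.sum_mul, Finset.sum_congr rfl h1]
    · rw [IsSelfAdjoint, star_sum]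
      exact Finset.sum_congr rfl fun i hi => (hP i hi).isSelfAdjoint.star_eq
  have h3 := hq.least _ h2 (by rintro _ ⟨i, hi, rfl⟩; exact h1 i hi)
  have h4 : (∑ i ∈ s, P i) * q = ∑ i ∈ s, P i := by
    rw [Finset.sum_mul]
    exact Finset.sum_congr rfl fun i hi => hq.le _ ⟨i, hi, rfl⟩
  exact h3.symm.trans (h2.mul_eq_left_comm hq.isStarProjection h4)

end Projections

namespace DirectedGraphOfGroups

variable {𝒢 : DirectedGraphOfGroups.{u}}

open SmallCat

/-! ### Edges with coset representatives -/

theorem Transversals.finite (hrow : 𝒢.IsRowFinite) (T : 𝒢.Transversals) (e : 𝒢.E) :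
    (T.set e).Finite :=
  have := hrow.index e
  (T.isComplement e).finite_left

/-- The edges with range `v`, each with a representative of a coset of its group. -/
noncomputable def cosetReps (hrow : 𝒢.IsRowFinite) (T : 𝒢.Transversals) (v : 𝒢.V) :
    Finset (Σ e, 𝒢.G (𝒢.r e)) :=
  (hrow.edges v).toFinset.sigma fun e => (T.finite hrow e).toFinset

theorem mem_cosetReps {hrow : 𝒢.IsRowFinite} {T : 𝒢.Transversals} {v : 𝒢.V}
    {p : Σ e, 𝒢.G (𝒢.r e)} : p ∈ cosetReps hrow T v ↔ 𝒢.r p.1 = v ∧ p.2 ∈ T.set p.1 := by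
  simp [cosetReps]

theorem finsum_eq_sum_cosetReps (hrow : 𝒢.IsRowFinite) (T : 𝒢.Transversals) (v : 𝒢.V)
    {M : Type*} [AddCommMonoid M] (F : ∀ e, 𝒢.G (𝒢.r e) → M) :
    ∑ᶠ (e : 𝒢.E) (_ : 𝒢.r e = v) (h : 𝒢.G (𝒢.r e)) (_ : h ∈ T.set e), F e h =
      ∑ p ∈ cosetReps hrow T v, F p.1 p.2 := by
  rw [cosetReps, Finset.sum_sigma]
  refine (finsum_mem_eq_finite_toFinset_sum (fun e => ∑ᶠ (h : 𝒢.G (𝒢.r e)) (_ : h ∈ T.set e),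
    F e h) (hrow.edges v)).trans ?_
  exact Finset.sum_congr rfl fun e _ => finsum_mem_eq_finite_toFinset_sum _ (T.finite hrow e)

theorem Transversals.exists_sameCoset (T : 𝒢.Transversals) {e : 𝒢.E} (g : 𝒢.G (𝒢.r e)) :
    ∃ h ∈ T.set e, ∃ c, g = h * 𝒢.α e c := by
  obtain ⟨⟨⟨h, hh⟩, ⟨_, c, rfl⟩⟩, rfl⟩ := (T.isComplement e).2 g
  exact ⟨h, hh, c, rfl⟩

theorem Transversals.eq_of_sameCoset (T : 𝒢.Transversals) {p q : Σ e, 𝒢.G (𝒢.r e)}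
    (hp : p.2 ∈ T.set p.1) (hq : q.2 ∈ T.set q.1) (h : SameCoset p q) : p = q := by
  obtain ⟨e, g⟩ := p
  obtain ⟨c, rfl⟩ := h
  have := @(T.isComplement e).1 (⟨g, hp⟩, ⟨𝒢.α e c, c, rfl⟩) (⟨g * 𝒢.α e c, hq⟩, 1) (by simp)
  have h2 : g = g * 𝒢.α e c := congrArg Subtype.val (congrArg Prod.fst this)
  exact congrArg (Sigma.mk e) h2

/-! ### From families of the graph of groups to Cuntz–Krieger families -/

variable {A : Type w} [NonUnitalCStarAlgebra A]

/-- The product of the operators along a word. -/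
def wordOp (S : 𝒢.E → A) (U : ∀ v, 𝒢.G v → A) : ∀ {v w : 𝒢.V}, 𝒢.Word v w → A
  | _, _, .elt g => U _ g
  | _, _, .cons e g x => U (𝒢.r e) g * S e * wordOp S U x

/-- The operators indexed by the word category. -/
noncomputable def morOp (S : 𝒢.E → A) (U : ∀ v, 𝒢.G v → A) (m : Mor 𝒢.WordCategory) : A :=
  wordOp S U (Word.exists_mor_eq m).choose

/-- This lets the formula `wordOp` be written in the universal algebra and checked in each
representation. -/
theorem map_wordOp {B : Type*} [NonUnitalCStarAlgebra B] (φ : A →⋆ₙₐ[ℂ] B) (S : 𝒢.E → A)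
    (U : ∀ v, 𝒢.G v → A) {v w : 𝒢.V} (x : 𝒢.Word v w) :
    φ (wordOp S U x) = wordOp (fun e => φ (S e)) (fun v g => φ (U v g)) x := by
  induction x with
  | elt g => rfl
  | cons e g x ih => simp only [wordOp, map_mul, ih]

namespace IsFamily

variable {T : 𝒢.Transversals} {S : 𝒢.E → A} {U : ∀ v, 𝒢.G v → A} (h : IsFamily T S U)

include h

theorem isStarProjection_one (v : 𝒢.V) : IsStarProjection (U v 1) :=
  isStarProjection_of_partialUnitary (by rw [← h.map_mul, mul_one]) (h.partialUnitary v 1).1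
    (h.partialUnitary v 1).2

/-- Writing `U v 1` as `U v g⁻¹ * U v g` shows that it lies below the initial projection of `U v g`;
the reverse inequality is `U v g * U v 1 = U v g`. -/
theorem star_U_mul_self (v : 𝒢.V) (g : 𝒢.G v) : star (U v g) * U v g = U v 1 := by
  have hp := h.isStarProjection_one v
  have hg := h.partialUnitary v g
  have h1 : star (U v g) * U v g * U v 1 = star (U v g) * U v g := by
    rw [mul_assoc, ← h.map_mul, mul_one]
  have h2 : U v 1 * (star (U v g) * U v g) = U v 1 := by
    conv_lhs => rw [← inv_mul_cancel g, h.map_mul, mul_assoc, ← mul_assoc (U v g), hg.1]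
    rw [← h.map_mul, inv_mul_cancel]
  have h3 := congrArg star h2
  rw [star_mul, hp.isSelfAdjoint.star_eq, star_mul, star_star, h1] at h3
  exact h3

theorem S_mul_one (e : 𝒢.E) : S e * U (𝒢.s e) 1 = S e := by
  rw [h.source, ← mul_assoc, h.partialIsometry]

theorem one_mul_S (e : 𝒢.E) : U (𝒢.r e) 1 * S e = S e := by
  have := h.slide e 1
  rwa [map_one, map_one, h.S_mul_one] at this

theorem wordOp_smul {v w : 𝒢.V} (g : 𝒢.G v) (x : 𝒢.Word v w) :
    wordOp S U (x.smul g) = U v g * wordOp S U x := by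
  cases x with
  | elt g' => exact h.map_mul _ _ _
  | cons e g' x => simp only [Word.smul, wordOp, h.map_mul, mul_assoc]

theorem wordOp_comp {v w z : 𝒢.V} (x : 𝒢.Word v w) (y : 𝒢.Word w z) :
    wordOp S U (x.comp y) = wordOp S U x * wordOp S U y := by
  induction x with
  | elt g => exact h.wordOp_smul g y
  | cons e g x ih => simp only [Word.comp, wordOp, ih, mul_assoc]

theorem one_mul_wordOp {v w : 𝒢.V} (x : 𝒢.Word v w) : U v 1 * wordOp S U x = wordOp S U x := by
  cases x with
  | elt g => exact (h.map_mul _ _ _).symm.trans (by rw [one_mul]; rfl)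
  | cons e g x => rw [wordOp, ← mul_assoc, ← mul_assoc, ← h.map_mul, one_mul]

theorem star_wordOp_mul_self {v w : 𝒢.V} (x : 𝒢.Word v w) :
    star (wordOp S U x) * wordOp S U x = U w 1 := by
  induction x with
  | elt g => exact h.star_U_mul_self _ g
  | cons e g x ih =>
    calc star (wordOp S U (.cons e g x)) * wordOp S U (.cons e g x)
        = star (wordOp S U x) * (star (S e) * ((star (U (𝒢.r e) g) * U (𝒢.r e) g) * S e)) *
            wordOp S U x := by simp only [wordOp, star_mul, mul_assoc]
      _ = star (wordOp S U x) * (U (𝒢.s e) 1 * wordOp S U x) := by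
        rw [h.star_U_mul_self, h.one_mul_S, h.source, mul_assoc]
      _ = _ := by rw [h.one_mul_wordOp, ih]

theorem wordOp_mul_one {v w : 𝒢.V} (x : 𝒢.Word v w) : wordOp S U x * U w 1 = wordOp S U x := by
  induction x with
  | elt g => exact (h.map_mul _ _ _).symm.trans (by rw [mul_one]; rfl)
  | cons e g x ih => rw [wordOp, mul_assoc, ih]

theorem wordOp_cons_mul (e : 𝒢.E) (g : 𝒢.G (𝒢.r e)) (c : 𝒢.Ge e) {w : 𝒢.V}
    (x : 𝒢.Word (𝒢.s e) w) : wordOp S U (.cons e (g * 𝒢.α e c) x) =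
      wordOp S U (.cons e g (x.smul (𝒢.αbar e c))) := by
  rw [wordOp, wordOp, h.wordOp_smul, h.map_mul, mul_assoc (U _ g), h.slide]
  simp only [mul_assoc]

theorem wordOp_eq_of_mor_eq (h𝒢 : 𝒢.IsCountable) {v w v' w' : 𝒢.V} {x : 𝒢.Word v w}
    {y : 𝒢.Word v' w'} (hxy : x.mor = y.mor) : wordOp S U x = wordOp S U y :=
  Word.congr_of_mor_eq h𝒢 (wordOp S U) (fun e g c _ _ x y hxy => by
    rw [h.wordOp_cons_mul, wordOp, wordOp, hxy]) x y hxy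

theorem morOp_mor (h𝒢 : 𝒢.IsCountable) {v w : 𝒢.V} (x : 𝒢.Word v w) :
    morOp S U x.mor = wordOp S U x :=
  h.wordOp_eq_of_mor_eq h𝒢 (Word.exists_mor_eq x.mor).choose_spec

theorem partialIsometry_wordOp {v w : 𝒢.V} (x : 𝒢.Word v w) :
    wordOp S U x * star (wordOp S U x) * wordOp S U x = wordOp S U x := by
  rw [mul_assoc, h.star_wordOp_mul_self, h.wordOp_mul_one]

theorem partialIsometry_U_mul_S (e : 𝒢.E) (g : 𝒢.G (𝒢.r e)) :
    U (𝒢.r e) g * S e * star (U (𝒢.r e) g * S e) * (U (𝒢.r e) g * S e) = U (𝒢.r e) g * S e := by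
  have := h.partialIsometry_wordOp (.cons e g (.elt 1))
  simpa only [wordOp, mul_assoc, h.S_mul_one] using this

theorem one_eq_sum (hrow : 𝒢.IsRowFinite) (v : 𝒢.V) : U v 1 = ∑ p ∈ cosetReps hrow T v,
    U (𝒢.r p.1) p.2 * S p.1 * star (U (𝒢.r p.1) p.2 * S p.1) := by
  rw [h.sum_eq v, ← finsum_eq_sum_cosetReps hrow T v
    (fun e g => U (𝒢.r e) g * S e * star (U (𝒢.r e) g * S e))]
  simp only [star_mul, mul_assoc]

theorem star_mul_eq_zero_of_ne {v w : 𝒢.V} (hvw : v ≠ w) {a b : A} (ha : U v 1 * a = a)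
    (hb : U w 1 * b = b) : star a * b = 0 := by
  rw [← ha, ← hb, star_mul, (h.isStarProjection_one v).isSelfAdjoint.star_eq, mul_assoc,
    ← mul_assoc (U v 1), h.orthogonal v w hvw, zero_mul, mul_zero]

theorem one_mul_U_mul_S (e : 𝒢.E) (g : 𝒢.G (𝒢.r e)) :
    U (𝒢.r e) 1 * (U (𝒢.r e) g * S e) = U (𝒢.r e) g * S e := by
  rw [← mul_assoc, ← h.map_mul, one_mul]

theorem orthogonal_of_mem (hrow : 𝒢.IsRowFinite) {v : 𝒢.V} {p q : Σ e, 𝒢.G (𝒢.r e)}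
    (hp : p ∈ cosetReps hrow T v) (hq : q ∈ cosetReps hrow T v) (hpq : p ≠ q) :
    star (U (𝒢.r p.1) p.2 * S p.1) * (U (𝒢.r q.1) q.2 * S q.1) = 0 := by
  refine star_mul_eq_zero_of_range_mul_eq_zero (h.partialIsometry_U_mul_S _ _)
    (h.partialIsometry_U_mul_S _ _) ?_
  refine mul_eq_zero_of_sum_mul_eq
    (P := fun p : Σ e, 𝒢.G (𝒢.r e) => U (𝒢.r p.1) p.2 * S p.1 * star (U (𝒢.r p.1) p.2 * S p.1))
    (fun p _ => isStarProjection_mul_star (h.partialIsometry_U_mul_S _ _)) (fun j hj => ?_)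
    hp hq hpq
  obtain ⟨rfl, -⟩ := mem_cosetReps.1 hj
  rw [← h.one_eq_sum hrow, ← mul_assoc, h.one_mul_U_mul_S]

/-- Replacing a group element by its representative in `T` changes the operator only by a right
factor `U (αbar e c)`, by the slide relation, so orthogonality need only be known on the
transversal. -/
theorem orthogonal_of_not_sameCoset (hrow : 𝒢.IsRowFinite) {p q : Σ e, 𝒢.G (𝒢.r e)}
    (hpq : ¬ SameCoset p q) :
    star (U (𝒢.r p.1) p.2 * S p.1) * (U (𝒢.r q.1) q.2 * S q.1) = 0 := by
  obtain ⟨e, g⟩ := p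
  obtain ⟨f, k⟩ := q
  by_cases hv : 𝒢.r e = 𝒢.r f
  · obtain ⟨g', hg', c, rfl⟩ := T.exists_sameCoset g
    obtain ⟨k', hk', d, rfl⟩ := T.exists_sameCoset k
    have h1 := h.orthogonal_of_mem hrow (v := 𝒢.r f) (p := ⟨e, g'⟩) (q := ⟨f, k'⟩)
      (mem_cosetReps.2 ⟨hv, hg'⟩) (mem_cosetReps.2 ⟨rfl, hk'⟩) (by
        intro heq
        obtain ⟨rfl, h2⟩ := Sigma.mk.inj heq
        obtain rfl := eq_of_heq h2
        exact hpq ⟨c⁻¹ * d, by simp [mul_assoc]⟩)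
    have hU (e : 𝒢.E) (g : 𝒢.G (𝒢.r e)) (c : 𝒢.Ge e) : U (𝒢.r e) (g * 𝒢.α e c) * S e =
        U (𝒢.r e) g * S e * U (𝒢.s e) (𝒢.αbar e c) := by
      rw [h.map_mul, mul_assoc, h.slide, mul_assoc]
    simp only at h1 ⊢
    rw [hU, hU, star_mul, mul_assoc, ← mul_assoc (star (_ * S e)), h1, zero_mul, mul_zero]
  · exact h.star_mul_eq_zero_of_ne hv (h.one_mul_U_mul_S _ _) (h.one_mul_U_mul_S _ _)

theorem star_wordOp_mul_eq_zero (hrow : 𝒢.IsRowFinite) {v w v' w' : 𝒢.V} {x : 𝒢.Word v w}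
    {y : 𝒢.Word v' w'} (hxy : Word.Diverge x y) : star (wordOp S U x) * wordOp S U y = 0 := by
  induction hxy with
  | vertex x y hv => exact h.star_mul_eq_zero_of_ne hv (h.one_mul_wordOp x) (h.one_mul_wordOp y)
  | head x y hc =>
    have := h.orthogonal_of_not_sameCoset hrow hc
    rw [wordOp, wordOp, star_mul, mul_assoc, ← mul_assoc (star _) _ (wordOp S U y), this, zero_mul,
      mul_zero]
  | @tail e g c w w' x y _ ih =>
    rw [h.wordOp_cons_mul]
    calc _ = star (wordOp S U x) * (star (S e) * ((star (U (𝒢.r e) g) * U (𝒢.r e) g) * S e)) *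
            wordOp S U (y.smul (𝒢.αbar e c)) := by simp only [wordOp, star_mul, mul_assoc]
      _ = star (wordOp S U x) * (U (𝒢.s e) 1 * wordOp S U (y.smul (𝒢.αbar e c))) := by
        rw [h.star_U_mul_self, h.one_mul_S, h.source, mul_assoc]
      _ = 0 := by rw [h.one_mul_wordOp, ih]

end IsFamily

end DirectedGraphOfGroups

/-! ### Relations (S3) and (S4) for the word operators -/

namespace DirectedGraphOfGroups

variable {𝒢 : DirectedGraphOfGroups.{u}}

open SmallCat

variable {A : Type w} [NonUnitalCStarAlgebra A]

namespace IsFamily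

variable {T : 𝒢.Transversals} {S : 𝒢.E → A} {U : ∀ v, 𝒢.G v → A} (h : IsFamily T S U)

include h

theorem isStarProjection_range {v w : 𝒢.V} (x : 𝒢.Word v w) :
    IsStarProjection (wordOp S U x * star (wordOp S U x)) :=
  isStarProjection_mul_star (h.partialIsometry_wordOp x)

theorem range_mul_wordOp_of_le (h𝒢 : 𝒢.IsCountable) {v w v' w' : 𝒢.V} {x : 𝒢.Word v w}
    {y : 𝒢.Word v' w'} (hxy : Le x.mor y.mor) :
    wordOp S U x * star (wordOp S U x) * wordOp S U y = wordOp S U y := by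
  obtain ⟨z, t, ht⟩ := Word.le_mor_iff.1 hxy
  rw [h.wordOp_eq_of_mor_eq h𝒢 ht, h.wordOp_comp, ← mul_assoc, h.partialIsometry_wordOp]

theorem isProjJoin_minCommonExt (h𝒢 : 𝒢.IsCountable) (hrow : 𝒢.IsRowFinite)
    (m n : Mor 𝒢.WordCategory) :
    IsProjJoin ((fun ξ => morOp S U ξ * star (morOp S U ξ)) '' minCommonExt m n)
      (morOp S U m * star (morOp S U m) * (morOp S U n * star (morOp S U n))) := by
  -- For comparable elements the longer one, `n`, is itself a minimal common extension and every
  -- other one extends it, so the join is attained at `n`.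
  have le_case (m n : Mor 𝒢.WordCategory) (hmn : Le m n) {P : Set (Mor 𝒢.WordCategory)}
      (hn : n ∈ P) (hP : ∀ ξ ∈ P, Le ξ n ∧ Le n ξ) :
      morOp S U m * star (morOp S U m) * (morOp S U n * star (morOp S U n)) =
          morOp S U n * star (morOp S U n) ∧
        IsProjJoin ((fun ξ => morOp S U ξ * star (morOp S U ξ)) '' P)
          (morOp S U n * star (morOp S U n)) := by
    have le_mul {m n : Mor 𝒢.WordCategory} (hmn : Le m n) :
        morOp S U m * star (morOp S U m) * (morOp S U n * star (morOp S U n)) =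
          morOp S U n * star (morOp S U n) := by
      obtain ⟨x, hx⟩ := Word.exists_mor_eq m
      obtain ⟨y, hy⟩ := Word.exists_mor_eq n
      rw [← hx, ← hy] at hmn ⊢
      rw [h.morOp_mor h𝒢, h.morOp_mor h𝒢, ← mul_assoc, h.range_mul_wordOp_of_le h𝒢 hmn]
    have proj (m : Mor 𝒢.WordCategory) : IsStarProjection (morOp S U m * star (morOp S U m)) :=
      h.isStarProjection_range _
    refine ⟨le_mul hmn, .of_mem (proj n) ⟨n, hn, rfl⟩ ?_⟩
    rintro _ ⟨ξ, hξ, rfl⟩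
    exact (proj ξ).mul_eq_right_comm (proj n) (le_mul (hP ξ hξ).2)
  obtain ⟨x, hx⟩ := Word.exists_mor_eq m
  obtain ⟨y, hy⟩ := Word.exists_mor_eq n
  obtain hmn | hmn | hxy := Word.le_or_le_or_diverge x y
  · rw [hx, hy] at hmn
    obtain ⟨h1, h2⟩ := le_case m n hmn (P := minCommonExt m n)
      ⟨⟨hmn, mor_le_refl n⟩, fun ⟨δ, hδ, _, hδ2⟩ => hδ2 hδ.2⟩
      fun ξ hξ => ⟨by_contra fun hc => hξ.2 ⟨n, ⟨hmn, mor_le_refl n⟩, hξ.1.2, hc⟩, hξ.1.2⟩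
    rwa [h1]
  · rw [hx, hy] at hmn
    obtain ⟨h1, h2⟩ := le_case n m hmn (P := minCommonExt m n)
      ⟨⟨mor_le_refl m, hmn⟩, fun ⟨δ, hδ, _, hδ2⟩ => hδ2 hδ.1⟩
      fun ξ hξ => ⟨by_contra fun hc => hξ.2 ⟨m, ⟨mor_le_refl m, hmn⟩, hξ.1.1, hc⟩, hξ.1.1⟩
    have h3 := congrArg star h1
    simp only [star_mul, star_star] at h3
    rwa [h3]
  · have h1 : minCommonExt m n = ∅ := by
      have := hxy.commonExt_eq_empty h𝒢
      rw [hx, hy] at this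
      exact Set.subset_empty_iff.1 fun ξ hξ => this ▸ hξ.1
    rw [h1, Set.image_empty, ← hx, ← hy, h.morOp_mor h𝒢, h.morOp_mor h𝒢]
    have h2 : wordOp S U x * star (wordOp S U x) * (wordOp S U y * star (wordOp S U y)) = 0 := by
      rw [mul_assoc, ← mul_assoc (star _), h.star_wordOp_mul_eq_zero hrow hxy, zero_mul, mul_zero]
    rw [h2]
    exact isProjJoin_empty

/-- An operator that annihilates all words of a given length starting at a vertex annihilates the
projection of that vertex. -/
theorem mul_one_eq_zero (hrow : 𝒢.IsRowFinite) (n : ℕ) (v : 𝒢.V) (a : A)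
    (ha : ∀ (w : 𝒢.V) (x : 𝒢.Word v w), x.length = n → a * wordOp S U x = 0) :
    a * U v 1 = 0 := by
  induction n generalizing v a with
  | zero => exact ha v (.elt 1) rfl
  | succ n ih =>
    -- Expanding by (4) peels off one edge, which is absorbed into `a`; hence `a` is arbitrary in
    -- the induction.
    rw [h.one_eq_sum hrow, Finset.mul_sum]
    refine Finset.sum_eq_zero fun p hp => ?_
    obtain ⟨rfl, -⟩ := mem_cosetReps.1 hp
    have := ih (𝒢.s p.1) (a * (U (𝒢.r p.1) p.2 * S p.1)) fun w x hx => by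
      rw [mul_assoc]
      exact ha w (.cons p.1 p.2 x) (congrArg (· + 1) hx)
    rw [mul_assoc, mul_assoc, h.S_mul_one] at this
    rw [← mul_assoc, this, zero_mul]

/-- A word longer than all members of `F` has a common extension with one of them, hence extends it,
and so its range lies below any `q` that dominates the projections of `F`. The ranges of such words
exhaust that of `U v 1`. -/
theorem isProjJoin_exhaustive (h𝒢 : 𝒢.IsCountable) (hrow : 𝒢.IsRowFinite) (v : 𝒢.V)
    (F : Set (Mor 𝒢.WordCategory)) (hF : F.Finite) (hFv : IsExhaustive ⟨v⟩ F) :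
    IsProjJoin ((fun ξ => morOp S U ξ * star (morOp S U ξ)) '' F) (U v 1) := by
  have hp := h.isStarProjection_one v
  refine ⟨hp, ?_, fun q hq hqF => ?_⟩
  · rintro _ ⟨ξ, hξ, rfl⟩
    obtain ⟨x, hx⟩ := Word.exists_mor_eq ξ
    obtain rfl : v = ξ.1.vert := congrArg WordCategory.vert (hFv.1 ξ hξ).symm
    refine (h.isStarProjection_range _).mul_eq_right_comm hp ?_
    rw [← mul_assoc, h.one_mul_wordOp]
  · choose t ht using fun m : Mor 𝒢.WordCategory => Word.exists_mor_eq m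
    obtain ⟨N, hN⟩ := (hF.image fun m => (t m).length).bddAbove
    have key : (q * U v 1 - U v 1) * U v 1 = 0 := by
      -- Length `N + 1` strictly exceeds every length in `F`, which excludes that `x` is a prefix of
      -- `β`.
      refine h.mul_one_eq_zero hrow (N + 1) v _ fun w x hx => ?_
      obtain ⟨β, hβ, hne⟩ := hFv.2 x.mor rfl
      have hle : Le β x.mor := by
        obtain hl | hl | he := le_or_le_or_commonExt_eq_empty h𝒢 x.mor β
        · rw [← ht β] at hl
          obtain ⟨z, y, hy⟩ := Word.le_mor_iff.1 hl
          have h1 := Word.length_eq_of_mor_eq h𝒢 hy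
          rw [Word.length_comp] at h1
          have h2 := hN ⟨β, hβ, rfl⟩
          dsimp only at h2
          omega
        · exact hl
        · exact absurd he hne.ne_empty
      rw [← ht β] at hle
      have h3 := h.range_mul_wordOp_of_le h𝒢 hle
      have h4 : q * (wordOp S U (t β) * star (wordOp S U (t β))) =
          wordOp S U (t β) * star (wordOp S U (t β)) := by
        refine (h.isStarProjection_range _).mul_eq_left_comm hq ?_
        rw [← h.morOp_mor h𝒢, ht]
        exact hqF _ ⟨β, hβ, rfl⟩
      rw [sub_mul, mul_assoc, h.one_mul_wordOp, ← h3, ← mul_assoc, h4, sub_self]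
    rw [sub_mul, mul_assoc, hp.isIdempotentElem, sub_eq_zero] at key
    exact hp.mul_eq_right_comm hq key

theorem isCKFamily (h𝒢 : 𝒢.IsCountable) (hrow : 𝒢.IsRowFinite) : IsCKFamily (morOp S U) where
  star_mul_self {v w} μ := by
    obtain ⟨μ, x, rfl⟩ := μ
    have h1 : (⟨w, w, 𝟙 w⟩ : Mor 𝒢.WordCategory) = Word.mor (.elt (1 : 𝒢.G w.vert)) :=
      congrArg (fun γ => (⟨w, w, γ⟩ : Mor 𝒢.WordCategory))
        (Subtype.ext (𝒢.fundGen_one w.vert).symm)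
    rw [h1, h.morOp_mor h𝒢]
    have h2 := h.star_wordOp_mul_self x
    rw [← h.morOp_mor h𝒢] at h2
    exact h2
  mul {v w z} μ ν := by
    obtain ⟨μ, x, rfl⟩ := μ
    obtain ⟨ν, y, rfl⟩ := ν
    have h1 := h.wordOp_comp x y
    rw [← h.morOp_mor h𝒢, ← h.morOp_mor h𝒢, ← h.morOp_mor h𝒢] at h1
    refine h1.symm.trans (congrArg (fun γ => morOp S U ⟨v, z, γ⟩) (Subtype.ext ?_))
    exact Word.image_comp x y
  join := h.isProjJoin_minCommonExt h𝒢 hrow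
  exhaustive v F hF hFv := by
    have h1 : (⟨v, v, 𝟙 v⟩ : Mor 𝒢.WordCategory) = Word.mor (.elt (1 : 𝒢.G v.vert)) :=
      congrArg (fun γ => (⟨v, v, γ⟩ : Mor 𝒢.WordCategory))
        (Subtype.ext (𝒢.fundGen_one v.vert).symm)
    rw [h1, h.morOp_mor h𝒢]
    exact h.isProjJoin_exhaustive h𝒢 hrow v.vert F hF hFv

end IsFamily

end DirectedGraphOfGroups

/-! ### Homomorphisms between universal C*-algebras -/

namespace CStarRelations

variable {X Y : Type u}

/-- A property of elements of the universal C*-algebra which holds for the generators and defines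
a closed *-subalgebra holds everywhere. -/
theorem mem_of_gen_mem (R : CStarRelations X) (K : NonUnitalStarSubalgebra ℂ R.Univ)
    (hK : IsClosed (K : Set R.Univ)) (h : ∀ x, R.gen x ∈ K) (a : R.Univ) : a ∈ K := by
  have key : ∀ (a : R.Product) (ha : a ∈ NonUnitalStarAlgebra.adjoin ℂ (Set.range R.prodGen)),
      (⟨a, NonUnitalStarSubalgebra.le_topologicalClosure _ ha⟩ : R.subalgebra) ∈
        (K : Set R.Univ) := by
    intro a ha
    induction ha using NonUnitalStarAlgebra.adjoin_induction with
    | mem x hx => obtain ⟨x, rfl⟩ := hx; exact h x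
    | add x y hx hy ihx ihy => exact K.add_mem ihx ihy
    | zero => exact K.zero_mem
    | mul x y hx hy ihx ihy => exact K.mul_mem ihx ihy
    | smul r x hx ihx => exact K.smul_mem r ihx
    | star x hx ihx => exact star_mem (S := NonUnitalStarSubalgebra ℂ R.Univ) (s := K) ihx
  obtain ⟨a, ha⟩ := a
  obtain ⟨b, hb, hlim⟩ := mem_closure_iff_seq_limit.1 ha
  have hlim' : Filter.Tendsto (fun n => (⟨b n,
      NonUnitalStarSubalgebra.le_topologicalClosure _ (hb n)⟩ : R.subalgebra)) Filter.atTop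
      (nhds ⟨a, ha⟩) := tendsto_subtype_rng.2 hlim
  exact hK.mem_of_tendsto hlim' (.of_forall fun n => key _ (hb n))

/-- If every family for `R'` yields a family for `R`, by a formula that makes sense in the
universal C*-algebra, then the universal C*-algebra of `R` maps to that of `R'`. -/
theorem exists_univ_hom (R : CStarRelations X) (R' : CStarRelations Y) (g : X → R'.Univ)
    (hg : ∀ π : R'.Rep, R.holds π.alg fun x => R'.eval π (g x)) :
    ∃ φ : R.Univ →⋆ₙₐ[ℂ] R'.Univ, ∀ x, φ (R.gen x) = g x := by
  -- The universal algebra lies one universe above the algebras in its universal property, so that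
  -- property cannot be applied to it as a target. The map is defined coordinatewise into the
  -- product, and its range is controlled by the generators.
  let ρ (π : R'.Rep) : R.Rep := ⟨π.alg, _, hg π⟩
  let φ₀ : R.Univ →⋆ₙₐ[ℂ] R'.Product :=
    { toFun := fun a => ⟨fun π => R.eval (ρ π) a, memℓp_infty ⟨‖a‖, by
        rintro _ ⟨π, rfl⟩
        exact NonUnitalStarAlgHom.norm_apply_le (R.eval (ρ π)) a⟩⟩
      map_smul' := fun _ _ => rfl
      map_zero' := rfl
      map_add' := fun _ _ => rfl
      map_mul' := fun _ _ => rfl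
      map_star' := fun _ => rfl }
  have hgen (x : X) : φ₀ (R.gen x) = (g x).1 := rfl
  have hcont : Continuous φ₀ :=
    (NonUnitalStarAlgHom.instContinuousLinearMapClassComplex
      (F := R.Univ →⋆ₙₐ[ℂ] R'.Product)).map_continuous φ₀
  have hmem (a : R.Univ) : φ₀ a ∈ R'.subalgebra :=
    R.mem_of_gen_mem (R'.subalgebra.comap φ₀)
      ((NonUnitalStarSubalgebra.isClosed_topologicalClosure _).preimage hcont)
      (fun x => (g x).2) a
  exact ⟨NonUnitalStarAlgHom.codRestrict φ₀ R'.subalgebra hmem, fun x => Subtype.ext (hgen x)⟩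

/-- Mutually inverse formulas for families give an isomorphism of universal C*-algebras. -/
theorem exists_univ_equiv (R : CStarRelations X) (R' : CStarRelations Y)
    (φ : R.Univ →⋆ₙₐ[ℂ] R'.Univ) (ψ : R'.Univ →⋆ₙₐ[ℂ] R.Univ)
    (hφψ : ∀ x, ψ (φ (R.gen x)) = R.gen x) (hψφ : ∀ y, φ (ψ (R'.gen y)) = R'.gen y) :
    ∃ Φ : R.Univ ≃⋆ₐ[ℂ] R'.Univ, ∀ a, Φ a = φ a :=
  ⟨StarAlgEquiv.ofNonUnitalStarAlgHom φ ψ (R.hom_ext _ _ hφψ) (R'.hom_ext _ _ hψφ), fun _ => rfl⟩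

theorem equiv_ext (R : CStarRelations X) {B : Type w} [NonUnitalCStarAlgebra B]
    (Φ Ψ : R.Univ ≃⋆ₐ[ℂ] B) (h : ∀ x, Φ (R.gen x) = Ψ (R.gen x)) : Φ = Ψ := by
  have := R.hom_ext (Φ : R.Univ →⋆ₙₐ[ℂ] B) (Ψ : R.Univ →⋆ₙₐ[ℂ] B) h
  exact StarAlgEquiv.ext fun a => DFunLike.congr_fun this a

end CStarRelations

/-! ### From Cuntz–Krieger families to families of the graph of groups -/

namespace DirectedGraphOfGroups

variable {𝒢 : DirectedGraphOfGroups.{u}}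

open SmallCat

variable {A : Type w} [NonUnitalCStarAlgebra A]

/-- A word with an edge extends the representative of its first coset. A group element is a prefix
of every word at its vertex, and some edge arrives there since there are no sources. -/
theorem isExhaustive_cosetReps (hrow : 𝒢.IsRowFinite) (hsrc : 𝒢.HasNoSources)
    (T : 𝒢.Transversals) (v : 𝒢.V) : IsExhaustive (⟨v⟩ : 𝒢.WordCategory)
      ((fun p : Σ e, 𝒢.G (𝒢.r e) => Word.mor (.cons p.1 p.2 (.elt 1))) '' cosetReps hrow T v) := by
  refine ⟨?_, fun m hm => ?_⟩
  · rintro _ ⟨p, hp, rfl⟩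
    exact congrArg WordCategory.mk (mem_cosetReps.1 hp).1
  · obtain ⟨x, hx⟩ := Word.exists_mor_eq m
    have hv : m.1.vert = v := congrArg WordCategory.vert hm
    rw [← hx]
    clear hx hm
    generalize m.1.vert = v' at x hv
    generalize m.2.1.vert = w at x
    subst hv
    cases x with
    | elt g =>
      obtain ⟨e, rfl⟩ := hsrc v'
      exact ⟨_, ⟨⟨e, 1⟩, mem_cosetReps.2 ⟨rfl, T.one_mem e⟩, rfl⟩, _, Word.le_mor_of_elt g _,
        mor_le_refl _⟩
    | cons e g x =>
      obtain ⟨h, hh, c, rfl⟩ := T.exists_sameCoset g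
      refine ⟨_, ⟨⟨e, h⟩, mem_cosetReps.2 ⟨rfl, hh⟩, rfl⟩, _, mor_le_refl _, ?_⟩
      rw [Word.mor_cons_mul]
      exact Word.le_mor_cons h (Word.le_mor_of_elt 1 _)

theorem apply_id_eq_apply_mor {B : Type*} (S : Mor 𝒢.WordCategory → B) (v : 𝒢.V) :
    S ⟨⟨v⟩, ⟨v⟩, 𝟙 _⟩ = S (Word.mor (.elt (1 : 𝒢.G v))) :=
  congrArg (fun γ => S ⟨⟨v⟩, ⟨v⟩, γ⟩) (Subtype.ext (𝒢.fundGen_one v).symm)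

section OfCKFamily

variable {S : Mor 𝒢.WordCategory → A} (h : IsCKFamily S)

include h

theorem ck_mul {v w z : 𝒢.V} (x : 𝒢.Word v w) (y : 𝒢.Word w z) :
    S x.mor * S y.mor = S (x.comp y).mor :=
  (h.mul (Word.toHom 𝒢 x) (Word.toHom 𝒢 y)).trans
    (congrArg (fun γ => S ⟨⟨v⟩, ⟨z⟩, γ⟩) (Subtype.ext (Word.image_comp x y).symm))

theorem ck_star_mul_self {v w : 𝒢.V} (x : 𝒢.Word v w) :
    star (S x.mor) * S x.mor = S (Word.mor (.elt (1 : 𝒢.G w))) :=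
  (h.star_mul_self (Word.toHom 𝒢 x)).trans (apply_id_eq_apply_mor S w)

theorem ck_isStarProjection (v : 𝒢.V) : IsStarProjection (S (Word.mor (.elt (1 : 𝒢.G v)))) := by
  have h1 := ck_star_mul_self h (.elt (1 : 𝒢.G v))
  have h2 := congrArg star h1
  rw [star_mul, star_star, h1] at h2
  rw [← h2] at h1
  exact ⟨h1, h2.symm⟩

theorem ck_mul_one {v w : 𝒢.V} (x : 𝒢.Word v w) :
    S x.mor * S (Word.mor (.elt (1 : 𝒢.G w))) = S x.mor := by
  rw [ck_mul h]
  refine congrArg S (Word.mor_eq_iff.2 ?_)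
  rw [Word.image_comp, Word.image, fundGen_one, Category.comp_id]

theorem ck_one_mul {v w : 𝒢.V} (x : 𝒢.Word v w) :
    S (Word.mor (.elt (1 : 𝒢.G v))) * S x.mor = S x.mor := by
  rw [ck_mul h]
  refine congrArg S (Word.mor_eq_iff.2 ?_)
  rw [Word.image_comp, Word.image, fundGen_one, Category.id_comp]

theorem ck_partialIsometry {v w : 𝒢.V} (x : 𝒢.Word v w) :
    S x.mor * star (S x.mor) * S x.mor = S x.mor := by
  rw [mul_assoc, ck_star_mul_self h, ck_mul_one h]

/-- In the corner of the projection at `v`, `S g` has the inverse `S g⁻¹`, and (S1) makes it an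
isometry there. -/
theorem ck_star_elt {v : 𝒢.V} (g : 𝒢.G v) :
    star (S (Word.mor (.elt g))) = S (Word.mor (.elt g⁻¹)) := by
  have h1 := congrArg star (ck_one_mul h (.elt g))
  rw [star_mul, (ck_isStarProjection h v).isSelfAdjoint.star_eq] at h1
  have h2 : S (Word.mor (.elt g)) * S (Word.mor (.elt g⁻¹)) = S (Word.mor (.elt (1 : 𝒢.G v))) :=
    (ck_mul h _ _).trans (by rw [Word.comp, Word.smul, mul_inv_cancel])
  rw [← h1, ← h2, ← mul_assoc, ck_star_mul_self h, ck_one_mul h]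

/-- Diverging words have no common extension, so (S3) equates the product with the join of the empty
set, which is zero. -/
theorem ck_orthogonal (h𝒢 : 𝒢.IsCountable) {v w v' w' : 𝒢.V} {x : 𝒢.Word v w} {y : 𝒢.Word v' w'}
    (hxy : Word.Diverge x y) :
    S x.mor * star (S x.mor) * (S y.mor * star (S y.mor)) = 0 := by
  have h1 := h.join x.mor y.mor
  have h2 : minCommonExt x.mor y.mor = ∅ :=
    Set.subset_empty_iff.1 fun ξ hξ => hxy.commonExt_eq_empty h𝒢 ▸ hξ.1
  rw [h2, Set.image_empty] at h1
  exact h1.eq_zero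

theorem ck_elt_mul_edge (e : 𝒢.E) (g : 𝒢.G (𝒢.r e)) :
    S (Word.mor (.elt g)) * S (Word.mor (.cons e 1 (.elt 1))) = S (Word.mor (.cons e g (.elt 1))) :=
  (ck_mul h _ _).trans (by rw [Word.comp, Word.smul, mul_one])

theorem isFamily_of_isCKFamily (h𝒢 : 𝒢.IsCountable) (hrow : 𝒢.IsRowFinite)
    (hsrc : 𝒢.HasNoSources) (T : 𝒢.Transversals) :
    IsFamily T (fun e => S (Word.mor (.cons e 1 (.elt 1)))) (fun _ g => S (Word.mor (.elt g))) where
  partialIsometry e := ck_partialIsometry h _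
  partialUnitary v g := by
    refine ⟨ck_partialIsometry h _, ?_⟩
    rw [ck_star_elt h, ck_mul h, ck_mul h, Word.comp, Word.comp, Word.smul, Word.smul,
      mul_inv_cancel, inv_mul_cancel]
  map_mul v g k := (ck_mul h (.elt g) (.elt k)).symm
  orthogonal v w hvw := by
    have h1 := ck_orthogonal h h𝒢 (.vertex (.elt (1 : 𝒢.G v)) (.elt (1 : 𝒢.G w)) hvw)
    simpa only [ck_star_elt h, inv_one, (ck_isStarProjection h _).isIdempotentElem.eq] using h1
  slide e c := by
    rw [ck_mul h, ck_mul h]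
    refine congrArg S (Word.mor_eq_iff.2 ?_)
    simp only [Word.image_comp, Word.image, fundGen_one, Category.id_comp, Category.comp_id]
    exact fundGen_slide e c
  source e := (ck_star_mul_self h _).symm
  sum_eq v := by
    rw [finsum_eq_sum_cosetReps hrow T v (fun e g => S (Word.mor (.elt g)) *
      S (Word.mor (.cons e 1 (.elt 1))) * star (S (Word.mor (.cons e 1 (.elt 1)))) *
      star (S (Word.mor (.elt g))))]
    have h1 := h.exhaustive _ _ ((cosetReps hrow T v).finite_toSet.image _)
      (isExhaustive_cosetReps hrow hsrc T v)
    rw [apply_id_eq_apply_mor S, Set.image_image] at h1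
    refine (h1.eq_sum (fun p _ => isStarProjection_mul_star (ck_partialIsometry h _))
      fun p hp q hq hpq => ?_).trans (Finset.sum_congr rfl fun p _ => ?_)
    · exact ck_orthogonal h h𝒢 (.head _ _ fun hc =>
        hpq (T.eq_of_sameCoset (mem_cosetReps.1 hp).2 (mem_cosetReps.1 hq).2 hc))
    · rw [mul_assoc, ← star_mul, ck_elt_mul_edge h]

theorem wordOp_of_isCKFamily {v w : 𝒢.V} (x : 𝒢.Word v w) :
    wordOp (fun e => S (Word.mor (.cons e 1 (.elt 1)))) (fun _ g => S (Word.mor (.elt g))) x =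
      S x.mor := by
  induction x with
  | elt g => rfl
  | cons e g x ih =>
    rw [wordOp, ih, ck_elt_mul_edge h, ck_mul h]
    refine congrArg S (Word.mor_eq_iff.2 ?_)
    simp only [Word.image_comp, Word.image, fundGen_one, Category.comp_id, Category.assoc]

end OfCKFamily

/-! ### The isomorphism and independence of the transversals -/

/-- The isomorphism of the two universal C*-algebras. -/
theorem exists_equiv_cuntzKriegerAlgebra (h𝒢 : 𝒢.IsCountable) (hrow : 𝒢.IsRowFinite)
    (hsrc : 𝒢.HasNoSources) (T : 𝒢.Transversals) :
    ∃ Φ : CStar T ≃⋆ₐ[ℂ] CuntzKriegerAlgebra 𝒢.WordCategory,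
      (∀ e, Φ (sGen T e) = ckGen (𝒢.wordEdge e)) ∧
      ∀ v (g : 𝒢.G v), Φ (uGen T v g) = ckGen (𝒢.wordElt g) := by
  have hck := isCKFamily_gen (C := 𝒢.WordCategory)
  have hfam := isFamily_gen hrow T
  obtain ⟨φ, hφ⟩ := CStarRelations.exists_univ_hom (relations T) (ckRelations 𝒢.WordCategory)
    (Sum.elim (fun e => ckGen (𝒢.wordEdge e)) fun p => ckGen (𝒢.wordElt p.2))
    fun π => isFamily_of_isCKFamily (IsCKFamily.mk π.holds.1 π.holds.2 π.holds.3 π.holds.4)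
      h𝒢 hrow hsrc T
  obtain ⟨ψ, hψ⟩ := CStarRelations.exists_univ_hom (ckRelations 𝒢.WordCategory) (relations T)
    (morOp (sGen T) (uGen T)) fun π => by
      have h1 : (fun m => (relations T).eval π (morOp (sGen T) (uGen T) m)) =
          morOp (fun e => π.toFun (.inl e)) (fun v g => π.toFun (.inr ⟨v, g⟩)) :=
        funext fun m => map_wordOp ((relations T).eval π) _ _ _
      rw [h1]
      exact IsFamily.isCKFamily π.holds h𝒢 hrow
  have hφs (e : 𝒢.E) : φ (sGen T e) = ckGen (𝒢.wordEdge e) := hφ (.inl e)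
  have hφu (v : 𝒢.V) (g : 𝒢.G v) : φ (uGen T v g) = ckGen (𝒢.wordElt g) := hφ (.inr ⟨v, g⟩)
  have hψw {v w : 𝒢.V} (x : 𝒢.Word v w) :
      ψ ((ckRelations 𝒢.WordCategory).gen x.mor) = wordOp (sGen T) (uGen T) x :=
    (hψ _).trans (hfam.morOp_mor h𝒢 x)
  obtain ⟨Φ, hΦ⟩ := CStarRelations.exists_univ_equiv (relations T) (ckRelations 𝒢.WordCategory) φ ψ
    (by
      rintro (e | ⟨v, g⟩)
      · refine (congrArg ψ (hφs e)).trans ((hψw (.cons e 1 (.elt 1))).trans ?_)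
        rw [wordOp, wordOp, hfam.one_mul_S, hfam.S_mul_one]
        rfl
      · exact (congrArg ψ (hφu v g)).trans (hψw (.elt g)))
    (by
      intro m
      obtain ⟨x, hx⟩ := Word.exists_mor_eq m
      rw [← hx, hψw, map_wordOp]
      simp only [hφs, hφu]
      exact wordOp_of_isCKFamily hck x)
  exact ⟨Φ, fun e => (hΦ _).trans (hφs e), fun v g => (hΦ _).trans (hφu v g)⟩

theorem CStar.equiv_ext {T : 𝒢.Transversals} {B : Type w} [NonUnitalCStarAlgebra B]
    {Φ Ψ : CStar T ≃⋆ₐ[ℂ] B} (hs : ∀ e, Φ (sGen T e) = Ψ (sGen T e))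
    (hu : ∀ v (g : 𝒢.G v), Φ (uGen T v g) = Ψ (uGen T v g)) : Φ = Ψ :=
  (relations T).equiv_ext Φ Ψ fun
    | .inl e => hs e
    | .inr ⟨v, g⟩ => hu v g

end DirectedGraphOfGroups

theorem mainTheorem3 (𝒢 : DirectedGraphOfGroups.{u}) (hcount : 𝒢.IsCountable)
    (hrow : 𝒢.IsRowFinite) (hsrc : 𝒢.HasNoSources) (T : 𝒢.Transversals) :
    (SmallCat.IsLeftCancellative 𝒢.WordCategory ∧ SmallCat.IsFinitelyAligned 𝒢.WordCategory) ∧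
    (∃! Φ : DirectedGraphOfGroups.CStar T ≃⋆ₐ[ℂ] SmallCat.CuntzKriegerAlgebra 𝒢.WordCategory,
      (∀ e, Φ (DirectedGraphOfGroups.sGen T e) = SmallCat.ckGen (𝒢.wordEdge e)) ∧
      ∀ v (g : 𝒢.G v), Φ (DirectedGraphOfGroups.uGen T v g) = SmallCat.ckGen (𝒢.wordElt g)) ∧
    ∀ T' : 𝒢.Transversals,
      ∃! Ψ : DirectedGraphOfGroups.CStar T ≃⋆ₐ[ℂ] DirectedGraphOfGroups.CStar T',
        (∀ e, Ψ (DirectedGraphOfGroups.sGen T e) = DirectedGraphOfGroups.sGen T' e) ∧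
        ∀ v (g : 𝒢.G v),
          Ψ (DirectedGraphOfGroups.uGen T v g) = DirectedGraphOfGroups.uGen T' v g := by
  open DirectedGraphOfGroups in
  refine ⟨⟨isLeftCancellative_wordCategory 𝒢, isFinitelyAligned_wordCategory hcount⟩, ?_,
    fun T' => ?_⟩
  · obtain ⟨Φ, hs, hu⟩ := exists_equiv_cuntzKriegerAlgebra hcount hrow hsrc T
    exact ⟨Φ, ⟨hs, hu⟩, fun Ψ hΨ => CStar.equiv_ext (fun e => (hΨ.1 e).trans (hs e).symm)
      fun v g => (hΨ.2 v g).trans (hu v g).symm⟩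
  -- Both algebras are identified with the same $\mathcal O(\Lambda)$, in which the images of the
  -- generators do not depend on the transversals.
  · obtain ⟨Φ, hs, hu⟩ := exists_equiv_cuntzKriegerAlgebra hcount hrow hsrc T
    obtain ⟨Φ', hs', hu'⟩ := exists_equiv_cuntzKriegerAlgebra hcount hrow hsrc T'
    have hs'' (e) : Φ.trans Φ'.symm (sGen T e) = sGen T' e :=
      (congrArg Φ'.symm ((hs e).trans (hs' e).symm)).trans (Φ'.symm_apply_apply _)
    have hu'' (v) (g : 𝒢.G v) : Φ.trans Φ'.symm (uGen T v g) = uGen T' v g :=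
      (congrArg Φ'.symm ((hu v g).trans (hu' v g).symm)).trans (Φ'.symm_apply_apply _)
    exact ⟨Φ.trans Φ'.symm, ⟨hs'', hu''⟩, fun Ψ hΨ => CStar.equiv_ext
      (fun e => (hΨ.1 e).trans (hs'' e).symm) fun v g => (hΨ.2 v g).trans (hu'' v g).symm⟩
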